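/- **Setting.** Let $m=-dt^2+(dx^1)^2+(dx^2)^2+(dx^3)^2$ be the Minkowski metric on $\mathbb R^{3+1}$. Let $\Omega\subseteq\mathbb R^3$ be a domain, let $f:\Omega\to\mathbb R$ be smooth with $|\partial f|_e<1$ everywhere on $\Omega$ (so that the graph of $f$ is a spacelike hypersurface), and let $S\subset\Omega$ be a closed (compact, without boundary), connected, smooth embedded surface. Write $f(S)=\{(f(x),x):x\in S\}\subset\mathbb R^{3+1}$, and let $\mathcal K_{ext}$ and $\mathcal K_{int}$ be the unbounded and the bounded component of $\mathbb R^3\setminus S$. Assume that $|f(p)-f(q)|<|p-q|_e$ for all $p\neq q$ in $S$ such that the open segment between $p$ and $q$ lies in $\mathcal K_{int}$. (This is automatic if $\mathcal K_{int}\subseteq\Omega$, for instance if $\Omega=\mathbb R^3$ or $\Omega$ is convex.) For $p\in S$ let $L[p]=(1,v)$ be the outgoing null normal to $f(S)$ at $(f(p),p)$: the unique vector of this form with $|v|_e=1$ that is $m$-orthogonal to the tangent space of $f(S)$ and for which $v$ points from $p$ into $\mathcal K_{ext}$. Let $g_0=e-df\otimes df$ be the metric induced by $m$ on the graph of $f$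 ($e$ being the Euclidean metric), let $\mathrm{dVol}_{S,g_0}$ be the area measure of the metric $\slashed g_0$ that it induces on $S\cong f(S)$, and let $\mathrm{tr}\chi_0=\mathrm{tr}_{\slashed g_0}\big((X,Y)\mapsto m(D_XL,Y)\big)$ be the flat null expansion, $D$ being the flat connection and $X,Y$ tangent to $f(S)$. For $\omega\in\mathbb S^2$, $u\in\mathbb R$ let $W_{\omega,u}=\{(t,x):t-\langle x,\omega\rangle_e\ge u\}$. Let $\mathbb K_+[S]$ be the intersection of all $W_{\omega,u}$ that contain $f(S)$ (the null convex hull), and let $S^+=\{p\in S:(f(p),p)\in\partial\mathbb K_+[S]\}$. **Proposition.** The set $S^+$ is non-empty, $(\mathrm{tr}\chi_0)^2$ is integrable over $S^+$, and $$\int_{S^+}(\mathrm{tr}\chi_0)^2\,\mathrm{dVol}_{S,g_0}\;\ge\;\frac{16(1+\sqrt2)\pi}{3}\,\inf_\Omega\big(1-|\partial f|_e^2\big).$$ -/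

import Mathlib

open scoped ContDiff Topology

noncomputable section

/-- The parameter plane `ℝ²`. -/
abbrev E2 : Type := EuclideanSpace ℝ (Fin 2)

/-- Euclidean space `ℝ³`. -/
abbrev E3 : Type := EuclideanSpace ℝ (Fin 3)

/-- The vector space `ℝ^{3+1}`, a point being written `(t, x)`. Only its linear structure and its
topology are used; the geometry is carried by `mink`. -/
abbrev Spacetime : Type := ℝ × E3

/-- The Minkowski metric `m = -dt² + (dx¹)² + (dx²)² + (dx³)²`. -/
def mink (X Y : Spacetime) : ℝ := -(X.1 * Y.1) + inner ℝ X.2 Y.2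

/-- The map `x ↦ (f x, x)`; the image of a set `S` under it is written `f(S)`. -/
def graphMap (f : E3 → ℝ) (x : E3) : Spacetime := (f x, x)

/-- A local parametrization `φ : V → S`: `V ⊆ ℝ²` is open and `φ` is a smooth injective immersion
of `V` which is a homeomorphism onto its image, this image being a relatively open subset of
`S`. (The values of `φ` outside `V` are irrelevant.) -/
structure IsLocalParam (S : Set E3) (φ : E2 → E3) (V : Set E2) : Prop where
  isOpen : IsOpen V
  smooth : ContDiffOn ℝ ∞ φ V
  immersion : ∀ y ∈ V, Function.Injective (fderiv ℝ φ y)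
  injOn : Set.InjOn φ V
  openMap : ∀ U ⊆ V, IsOpen U → ∃ W : Set E3, IsOpen W ∧ φ '' U = S ∩ W

/-- `S` is a closed (i.e. compact and without boundary), connected, smooth embedded surface in
`ℝ³`. -/
structure IsClosedEmbeddedSurface (S : Set E3) : Prop where
  isCompact : IsCompact S
  isConnected : IsConnected S
  exists_param : ∀ p ∈ S, ∃ (φ : E2 → E3) (V : Set E2), IsLocalParam S φ V ∧ p ∈ φ '' V

/-- `𝒦_ext`: the unbounded component of `ℝ³ \ S`. -/
def extRegion (S : Set E3) : Set E3 :=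
  {x | x ∉ S ∧ ¬ Bornology.IsBounded (connectedComponentIn Sᶜ x)}

/-- The bounded component of `ℝ³ \ S` (the open region enclosed by `S`). -/
def intRegion (S : Set E3) : Set E3 :=
  {x | x ∉ S ∧ Bornology.IsBounded (connectedComponentIn Sᶜ x)}

/-- The tangent vectors of a set `M` at `q`: velocities at `q` of curves in `M`. For an embedded
submanifold this is the tangent space. -/
def tangentVectors (M : Set Spacetime) (q : Spacetime) : Set Spacetime :=
  {X | ∃ γ : ℝ → Spacetime, γ 0 = q ∧ (∀ᶠ t in 𝓝 (0 : ℝ), γ t ∈ M) ∧ HasDerivAt γ X 0}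

/-- `L = (1, v)` with `|v| = 1` is `m`-orthogonal to the tangent space of `f(S)` at `(f p, p)`, and
`v` points from `p` into `𝒦_ext`. -/
structure IsOutgoingNullNormal (S : Set E3) (f : E3 → ℝ) (p : E3) (L : Spacetime) : Prop where
  time_eq_one : L.1 = 1
  norm_eq_one : ‖L.2‖ = 1
  normal : ∀ X ∈ tangentVectors (graphMap f '' S) (graphMap f p), mink L X = 0
  outgoing : ∃ ε > 0, ∀ s ∈ Set.Ioo (0 : ℝ) ε, p + s • L.2 ∈ extRegion S

/-- The normalized outgoing null normal `L^{f(S)}[p]`: the unique vector satisfying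
`IsOutgoingNullNormal`. -/
def outgoingNullNormal (S : Set E3) (f : E3 → ℝ) (p : E3) : Spacetime :=
  Classical.epsilon (IsOutgoingNullNormal S f p)

/-- The coordinate tangent vector `∂_A` of `f(S)` in the parametrization `(f ∘ φ, φ)`. -/
def coordVec (f : E3 → ℝ) (φ : E2 → E3) (y : E2) (A : Fin 2) : Spacetime :=
  fderiv ℝ (fun z => graphMap f (φ z)) y (EuclideanSpace.single A 1)

/-- The components of the metric induced by `m` on `f(S)`, equivalently of the metric induced by
`g₀ = e - df ⊗ df` on `S`. -/
def inducedMetric (f : E3 → ℝ) (φ : E2 → E3) (y : E2) : Matrix (Fin 2) (Fin 2) ℝ :=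
  Matrix.of fun A B => mink (coordVec f φ y A) (coordVec f φ y B)

/-- The components `⟨D_{∂_A} L, ∂_B⟩_m` of the null second fundamental form, `D` being the flat
connection and `L` the outgoing null normal field. -/
def nullSecondForm (S : Set E3) (f : E3 → ℝ) (φ : E2 → E3) (y : E2) :
    Matrix (Fin 2) (Fin 2) ℝ :=
  Matrix.of fun A B =>
    mink (fderiv ℝ (fun z => outgoingNullNormal S f (φ z)) y (EuclideanSpace.single A 1))
      (coordVec f φ y B)

open Classical in
/-- The flat null expansion `tr χ₀` at `p`: the trace of the null second fundamental form with
respect to the induced metric, computed in some local parametrization around `p` (the trace does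
not depend on which one). -/
def nullExpansion (S : Set E3) (f : E3 → ℝ) (p : E3) : ℝ :=
  if h : ∃ c : (E2 → E3) × Set E2 × E2, IsLocalParam S c.1 c.2.1 ∧ c.2.2 ∈ c.2.1 ∧ c.1 c.2.2 = p
  then ((inducedMetric f h.choose.1 h.choose.2.2)⁻¹ *
      nullSecondForm S f h.choose.1 h.choose.2.2).trace
  else 0

/-- The Riemannian area measure `dVol_{S,g₀}`, as a measure on `ℝ³` carried by `S`. On the image of
a local parametrization it is the push-forward of `√(det g) dy¹dy²`, where `g` is the induced
metric; since these local measures agree on overlaps, their supremum is the measure they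
define together. -/
def areaMeasure (S : Set E3) (f : E3 → ℝ) : MeasureTheory.Measure E3 :=
  ⨆ (φ : E2 → E3) (V : Set E2) (_ : IsLocalParam S φ V),
    MeasureTheory.Measure.map φ
      ((MeasureTheory.volume.restrict V).withDensity
        fun y => ENNReal.ofReal (Real.sqrt (inducedMetric f φ y).det))

/-- The half-space `W_{w,u} = {(t, x) : t - ⟨x, w⟩ ≥ u}`. -/
def nullHalfSpace (w : E3) (u : ℝ) : Set Spacetime :=
  {z | u ≤ z.1 - inner ℝ z.2 w}

/-- The null convex hull `𝕂₊[S]`: the intersection of all `W_{w,u}`, `w ∈ 𝕊²`, `u ∈ ℝ`, that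
contain `f(S)`. -/
def nullConvexHull (S : Set E3) (f : E3 → ℝ) : Set Spacetime :=
  {z | ∀ (w : E3) (u : ℝ), ‖w‖ = 1 → graphMap f '' S ⊆ nullHalfSpace w u → z ∈ nullHalfSpace w u}

/-- The subset `S⁺` of `S` of points that `f` maps to the boundary of the null convex hull. -/
def SPlus (S : Set E3) (f : E3 → ℝ) : Set E3 :=
  {p | p ∈ S ∧ graphMap f p ∈ frontier (nullConvexHull S f)}

end

/-!
For a unit vector `w`, let `p` minimize the retarded time `f - ⟨·, w⟩` on `S`. The points arising
in this way, for all `w`, are exactly the points of `S⁺` (`mem_SPlus_iff`). At such a point `(1, w)`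
is a null normal of `f(S)`, and it is the outgoing one: otherwise the ray from `p` in the direction
`w` would enter the interior and leave it at a point `q` of `S`, where the chord condition makes the
retarded time smaller than at `p` (`IsOrientedChart.eq_nullDir_of_isMinOn`). So the map `v` sending
a point to the spatial part of its outgoing null normal takes `S⁺` onto the whole unit sphere.

At a minimizer, the null second fundamental form `χ` is the Hessian of the retarded time along `S`,
hence symmetric and positive semidefinite, and the arithmetic-geometric mean inequality gives
`(tr χ)² ≥ 4 det χ / det g`. Comparing Gram determinants shows that `det χ / √(det g)` is the
Jacobian of `v` (`IsOrientedChart.four_mul_abs_tripleDet_le`). Integrating, `∫ (tr χ)²` over `S⁺` is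
at least four times the area of the sphere, that is `16 π`; this exceeds the claimed bound because
`(1 + √2) / 3 < 1` and `1 - |∂f|² ≤ 1`. The area of the sphere is measured through the volume of
cones, since the inequality between the volume of an image and the integral of the Jacobian is
available for maps between spaces of equal dimension (`volume_cone_le`).

That the outgoing null normal is well defined and smooth rests on Jordan–Brouwer separation: near
each point of `S` one side of `S` is exterior and the other one interior
(`IsFlatNhd.bounded_unbounded`). To prove it, "lying on the same side" is viewed as a
`ℤ/2`-valued cocycle on pairs of nearby points. On a ball such a cocycle is a coboundary, by summing
it along radii (`exists_primitive_of_cocycle`), and a primitive is a two-colouring of the complement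
of `S` which changes across `S`.

In adapted charts (`IsOrientedChart`), the null normal is the restriction of an explicit `C¹`
vector field on space, so `tr χ` is continuous on `S`; with the finiteness of the area, which
follows by change of variables between parametrizations, this gives integrability.
-/

open MeasureTheory

/-! ### Separation of space by a locally flat hypersurface -/

/-- `U` is an open set which `S` cuts, along the zero set of `h`, into the two preconnected
sides `{0 < h}` and `{h < 0}`, every point of `S ∩ U` being adherent to both. (If `S` does not
meet `U`, one of the sides may be empty.) -/
structure IsFlatNhd {E : Type*} [TopologicalSpace E] (S U : Set E) (h : E → ℝ) : Prop where
  isOpen : IsOpen U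
  contOn : ContinuousOn h U
  mem_iff : ∀ x ∈ U, (x ∈ S ↔ h x = 0)
  preconn_pos : IsPreconnected {x | x ∈ U ∧ 0 < h x}
  preconn_neg : IsPreconnected {x | x ∈ U ∧ h x < 0}
  mem_closure_pos : ∀ x ∈ U, x ∈ S → x ∈ closure {x | x ∈ U ∧ 0 < h x}
  mem_closure_neg : ∀ x ∈ U, x ∈ S → x ∈ closure {x | x ∈ U ∧ h x < 0}

/-- `S` is a locally flat hypersurface: its points have arbitrarily small flat neighbourhoods. -/
def IsLocallyFlat {E : Type*} [TopologicalSpace E] (S : Set E) : Prop :=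
  ∀ p ∈ S, ∀ N ∈ 𝓝 p, ∃ (U : Set E) (h : E → ℝ), IsFlatNhd S U h ∧ p ∈ U ∧ U ⊆ N

open Classical in
/-- The side of `x` with respect to `h`, as an element of `ℤ/2`. -/
noncomputable def side {E : Type*} (h : E → ℝ) (x : E) : ZMod 2 := if 0 < h x then 1 else 0

theorem ZMod.eq_zero_or_one (k : ZMod 2) : k = 0 ∨ k = 1 := by
  revert k; decide

/-- A `ZMod 2`-valued function on pairs of nearby points of a ball which satisfies the cocycle
identity is a coboundary. The primitive at `x` is the sum of the cocycle along a fine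
subdivision of the segment from the centre to `x`. -/
theorem exists_primitive_of_cocycle {E : Type*} [NormedAddCommGroup E] [NormedSpace ℝ E]
    (R δ : ℝ) (hδ : 0 < δ) (s : E → E → ZMod 2)
    (hs : ∀ x y z, ‖x‖ ≤ R → ‖y‖ ≤ R → ‖z‖ ≤ R → dist x y < δ → dist y z < δ → dist x z < δ →
      s x y + s y z = s x z) :
    ∃ c : E → ZMod 2, ∀ x y, ‖x‖ ≤ R → ‖y‖ ≤ R → dist x y < δ / 2 → c x + c y = s x y := by
  obtain ⟨N, hN⟩ := exists_nat_gt (max 1 (2 * R / δ))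
  have hN0 : (0 : ℝ) < N := lt_of_lt_of_le one_pos ((le_max_left _ _).trans hN.le)
  have hNR : R / N < δ / 2 := by
    have := (le_max_right _ _).trans_lt hN
    rw [div_lt_iff₀ hδ] at this
    rw [div_lt_iff₀ hN0]; linarith
  let pt : ℕ → E → E := fun i x => ((i : ℝ) / N) • x
  refine ⟨fun x => ∑ i ∈ Finset.range N, s (pt i x) (pt (i + 1) x), fun x y hx hy hxy => ?_⟩
  have hcoef : ∀ i ≤ N, 0 ≤ (i : ℝ) / N ∧ (i : ℝ) / N ≤ 1 := fun i hi =>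
    ⟨by positivity, by rw [div_le_one hN0]; exact_mod_cast hi⟩
  have hnorm : ∀ i ≤ N, ∀ z, ‖z‖ ≤ R → ‖pt i z‖ ≤ R := by
    intro i hi z hz
    simp only [pt, norm_smul, Real.norm_eq_abs, abs_of_nonneg (hcoef i hi).1]
    exact (mul_le_of_le_one_left (norm_nonneg _) (hcoef i hi).2).trans hz
  have hd1 : ∀ i ≤ N, dist (pt i x) (pt i y) < δ / 2 := by
    intro i hi
    simp only [pt, dist_smul₀, Real.norm_eq_abs, abs_of_nonneg (hcoef i hi).1]
    exact (mul_le_of_le_one_left dist_nonneg (hcoef i hi).2).trans_lt hxy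
  have hd2 : ∀ i, ∀ z, ‖z‖ ≤ R → dist (pt i z) (pt (i + 1) z) < δ / 2 := by
    intro i z hz
    rw [dist_comm, dist_eq_norm]
    have : pt (i + 1) z - pt i z = (1 / (N : ℝ)) • z := by
      simp only [pt, ← sub_smul]; congr 1; push_cast; ring
    rw [this, norm_smul, Real.norm_eq_abs, abs_of_nonneg (by positivity)]
    refine lt_of_le_of_lt ?_ hNR
    rw [div_mul_eq_mul_div, one_mul]; gcongr
  have hself : ∀ z, ‖z‖ ≤ R → s z z = 0 := by
    intro z hz
    have := hs z z z hz hz hz (by simpa) (by simpa) (by simpa)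
    simpa using this
  have hR0 : 0 ≤ R := (norm_nonneg _).trans hx
  have key : ∀ n ≤ N, ∑ i ∈ Finset.range n, s (pt i x) (pt (i + 1) x)
      + ∑ i ∈ Finset.range n, s (pt i y) (pt (i + 1) y) = s (pt n x) (pt n y) := by
    intro n
    induction n with
    | zero => intro _; simp [pt, hself 0 (by simpa)]
    | succ n ih =>
      intro hn
      have hn' : n ≤ N := by omega
      rw [Finset.sum_range_succ, Finset.sum_range_succ]
      have h1 := ih hn'
      have nx := hnorm n hn' x hx
      have ny := hnorm n hn' y hy
      have nx' := hnorm (n + 1) hn x hx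
      have ny' := hnorm (n + 1) hn y hy
      have d1 := hd1 n hn'
      have d1' := hd1 (n + 1) hn
      have d2 := hd2 n x hx
      have d2' := hd2 n y hy
      have d3 : dist (pt n x) (pt (n + 1) y) < δ := by
        linarith [dist_triangle (pt n x) (pt n y) (pt (n + 1) y)]
      have e1 := hs _ _ _ nx nx' ny' (by linarith) (by linarith) d3
      have e2 := hs _ _ _ nx ny ny' (by linarith) (by linarith) d3
      generalize s (pt n x) (pt (n + 1) x) = a at *
      generalize s (pt n y) (pt (n + 1) y) = b at *
      generalize s (pt n x) (pt n y) = d at *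
      generalize s (pt (n + 1) x) (pt (n + 1) y) = e at *
      generalize s (pt n x) (pt (n + 1) y) = f at *
      generalize ∑ i ∈ Finset.range n, s (pt i x) (pt (i + 1) x) = A at *
      generalize ∑ i ∈ Finset.range n, s (pt i y) (pt (i + 1) y) = B at *
      clear * - h1 e1 e2
      subst h1 e1
      revert a b e A B; decide
  have := key N le_rfl
  have h1 : ∀ z, pt N z = z := fun z => by simp [pt, hN0.ne']
  rwa [h1, h1] at this

section
variable {E : Type*} [TopologicalSpace E] {S U U' : Set E} {h h' : E → ℝ}

theorem IsFlatNhd.side_eventually_const (H : IsFlatNhd S U h) {x : E} (hx : x ∈ U) (hxS : x ∉ S) :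
    ∀ᶠ z in 𝓝 x, side h z = side h x := by
  have hne : h x ≠ 0 := fun h0 => hxS ((H.mem_iff x hx).2 h0)
  have hc : ContinuousAt h x := H.contOn.continuousAt (H.isOpen.mem_nhds hx)
  rcases lt_or_gt_of_ne hne with hlt | hgt
  · filter_upwards [hc.eventually (gt_mem_nhds hlt)] with z hz
    simp [side, not_lt.2 hlt.le, not_lt.2 (le_of_lt hz)]
  · filter_upwards [hc.eventually (lt_mem_nhds hgt)] with z hz
    simp only [side]; rw [if_pos hz, if_pos hgt]

theorem IsFlatNhd.side_const (H : IsFlatNhd S U h) {C : Set E} (hC : IsPreconnected C)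
    (hCU : C ⊆ U) (hCS : Disjoint C S) {x y : E} (hx : x ∈ C) (hy : y ∈ C) :
    side h x = side h y := by
  refine hC.constant (f := side h) ?_ hx hy
  intro z hz
  have : ContinuousAt (side h) z :=
    (continuousAt_const (y := side h z)).congr
      ((H.side_eventually_const (hCU hz) (Set.disjoint_left.1 hCS hz)).mono fun _ h => h.symm)
  exact this.continuousWithinAt

/-- Two flat neighbourhoods distinguish the sides of `S` in the same way, up to a global swap, on
each preconnected set in their intersection. -/
theorem IsFlatNhd.exists_side_add_side_eq (hS : IsLocallyFlat S) (H : IsFlatNhd S U h)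
    (H' : IsFlatNhd S U' h') {B : Set E} (hB : IsPreconnected B) (hBU : B ⊆ U)
    (hBU' : B ⊆ U') : ∃ k : ZMod 2, ∀ x ∈ B, x ∉ S → side h x + side h' x = k := by
  let A : ZMod 2 → Set E := fun k => interior {z | z ∉ S → side h z + side h' z = k}
  have hcover : ∀ x ∈ B, ∃ k, x ∈ A k := by
    intro x hx
    by_cases hxS : x ∈ S
    · obtain ⟨Q, g, HQ, hxQ, hQ⟩ := hS x hxS (U ∩ U')
        (((H.isOpen.inter H'.isOpen)).mem_nhds ⟨hBU hx, hBU' hx⟩)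
      have hposS : Disjoint {x | x ∈ Q ∧ 0 < g x} S := Set.disjoint_left.2 fun z hz hzS =>
        hz.2.ne' ((HQ.mem_iff z hz.1).1 hzS)
      have hnegS : Disjoint {x | x ∈ Q ∧ g x < 0} S := Set.disjoint_left.2 fun z hz hzS =>
        hz.2.ne ((HQ.mem_iff z hz.1).1 hzS)
      obtain ⟨a, ha, haQ⟩ := mem_closure_iff.1 (HQ.mem_closure_pos x hxQ hxS) Q HQ.isOpen hxQ
      obtain ⟨b, hb, hbQ⟩ := mem_closure_iff.1 (HQ.mem_closure_neg x hxQ hxS) Q HQ.isOpen hxQ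
      -- each of the two side functions separates the two sides of `S` in `Q`
      have hsep : ∀ (V : Set E) (k : E → ℝ), IsFlatNhd S V k → Q ⊆ V →
          side k a ≠ side k b ∧ (∀ z ∈ Q, 0 < g z → side k z = side k a) ∧
          (∀ z ∈ Q, g z < 0 → side k z = side k b) := by
        intro V k HV hQV
        have h1 : ∀ z ∈ Q, 0 < g z → side k z = side k a := fun z hz hgz =>
          HV.side_const HQ.preconn_pos (fun _ hw => hQV hw.1) hposS ⟨hz, hgz⟩ haQ
        have h2 : ∀ z ∈ Q, g z < 0 → side k z = side k b := fun z hz hgz =>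
          HV.side_const HQ.preconn_neg (fun _ hw => hQV hw.1) hnegS ⟨hz, hgz⟩ hbQ
        refine ⟨fun hab => ?_, h1, h2⟩
        have hall : ∀ z ∈ Q, z ∉ S → side k z = side k a := by
          intro z hz hzS
          rcases lt_trichotomy (g z) 0 with h0 | h0 | h0
          · rw [h2 z hz h0, hab]
          · exact absurd ((HQ.mem_iff z hz).2 h0) hzS
          · exact h1 z hz h0
        obtain ⟨u, hu, huk⟩ :=
          mem_closure_iff.1 (HV.mem_closure_pos x (hQV hxQ) hxS) Q HQ.isOpen hxQ
        obtain ⟨w, hw, hwk⟩ :=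
          mem_closure_iff.1 (HV.mem_closure_neg x (hQV hxQ) hxS) Q HQ.isOpen hxQ
        have e1 := hall u hu fun hh => huk.2.ne' ((HV.mem_iff u huk.1).1 hh)
        have e2 := hall w hw fun hh => hwk.2.ne ((HV.mem_iff w hwk.1).1 hh)
        have e3 : side k u = 1 := if_pos huk.2
        have e4 : side k w = 0 := if_neg (not_lt.2 hwk.2.le)
        rw [e3] at e1; rw [e4, ← e1] at e2
        exact absurd e2 (by decide)
      obtain ⟨n1, p1, q1⟩ := hsep U h H (hQ.trans Set.inter_subset_left)
      obtain ⟨n2, p2, q2⟩ := hsep U' h' H' (hQ.trans Set.inter_subset_right)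
      refine ⟨side h a + side h' a, mem_interior.2 ⟨Q, fun z hz hzS => ?_, HQ.isOpen, hxQ⟩⟩
      rcases lt_trichotomy (g z) 0 with h0 | h0 | h0
      · rw [q1 z hz h0, q2 z hz h0]
        generalize side h a = a1 at *; generalize side h b = b1 at *
        generalize side h' a = a2 at *; generalize side h' b = b2 at *
        clear * - n1 n2
        revert a1 b1 a2 b2; decide
      · exact absurd ((HQ.mem_iff z hz).2 h0) hzS
      · rw [p1 z hz h0, p2 z hz h0]
    · refine ⟨side h x + side h' x, mem_interior_iff_mem_nhds.2 ?_⟩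
      filter_upwards [H.side_eventually_const (hBU hx) hxS,
        H'.side_eventually_const (hBU' hx) hxS] with z h1 h2 _
      rw [h1, h2]
  have hsub : ∀ k, ∀ x ∈ A k, x ∉ S → side h x + side h' x = k := fun k x hx hxS =>
    interior_subset hx hxS
  by_cases hne : (B ∩ A 0).Nonempty
  · by_cases hne' : (B ∩ A 1).Nonempty
    · obtain ⟨x, hxB, hx0, hx1⟩ := hB (A 0) (A 1) isOpen_interior isOpen_interior
        (fun x hx => by
          obtain ⟨k, hk⟩ := hcover x hx
          rcases ZMod.eq_zero_or_one k with rfl | rfl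
          · exact Or.inl hk
          · exact Or.inr hk) hne hne'
      exfalso
      have hxnS : ∃ z, z ∈ A 0 ∩ A 1 ∧ z ∉ S := by
        by_cases hxS : x ∈ S
        · obtain ⟨z, hz, hzU⟩ := mem_closure_iff.1 (H.mem_closure_pos x (hBU hxB) hxS)
            (A 0 ∩ A 1) (isOpen_interior.inter isOpen_interior) ⟨hx0, hx1⟩
          exact ⟨z, hz, fun hh => hzU.2.ne' ((H.mem_iff z hzU.1).1 hh)⟩
        · exact ⟨x, ⟨hx0, hx1⟩, hxS⟩
      obtain ⟨z, ⟨hz0, hz1⟩, hzS⟩ := hxnS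
      have := (hsub 0 z hz0 hzS).symm.trans (hsub 1 z hz1 hzS)
      exact absurd this (by decide)
    · refine ⟨0, fun x hx hxS => ?_⟩
      obtain ⟨k, hk⟩ := hcover x hx
      rcases ZMod.eq_zero_or_one k with rfl | rfl
      · exact hsub 0 x hk hxS
      · exact absurd ⟨x, hx, hk⟩ hne'
  · refine ⟨1, fun x hx hxS => ?_⟩
    obtain ⟨k, hk⟩ := hcover x hx
    rcases ZMod.eq_zero_or_one k with rfl | rfl
    · exact absurd ⟨x, hx, hk⟩ hne
    · exact hsub 1 x hk hxS

theorem IsLocallyFlat.dense_compl (hS : IsLocallyFlat S) : Dense Sᶜ := by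
  intro x
  by_cases hx : x ∈ S
  · obtain ⟨U, h, H, hxU, -⟩ := hS x hx Set.univ Filter.univ_mem
    exact closure_mono (fun z hz hzS => hz.2.ne' ((H.mem_iff z hz.1).1 hzS))
      (H.mem_closure_pos x hxU hx)
  · exact subset_closure hx

theorem IsFlatNhd.disjoint_pos (H : IsFlatNhd S U h) : {x | x ∈ U ∧ 0 < h x} ⊆ Sᶜ :=
  fun z hz hzS => hz.2.ne' ((H.mem_iff z hz.1).1 hzS)

theorem IsFlatNhd.disjoint_neg (H : IsFlatNhd S U h) : {x | x ∈ U ∧ h x < 0} ⊆ Sᶜ :=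
  fun z hz hzS => hz.2.ne ((H.mem_iff z hz.1).1 hzS)

theorem IsFlatNhd.neg (H : IsFlatNhd S U h) : IsFlatNhd S U (fun x => -h x) where
  isOpen := H.isOpen
  contOn := H.contOn.neg
  mem_iff x hx := by rw [H.mem_iff x hx, neg_eq_zero]
  preconn_pos := by simpa using H.preconn_neg
  preconn_neg := by simpa using H.preconn_pos
  mem_closure_pos := by simpa using H.mem_closure_neg
  mem_closure_neg := by simpa using H.mem_closure_pos

end

section
variable {E : Type*} [NormedAddCommGroup E] [NormedSpace ℝ E] {S : Set E}

/-- Every point, on `S` or off it, has a flat neighbourhood. -/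
theorem IsLocallyFlat.exists_isFlatNhd (hS : IsLocallyFlat S) (hcl : IsClosed S) (x : E) :
    ∃ (U : Set E) (h : E → ℝ), IsFlatNhd S U h ∧ x ∈ U := by
  by_cases hx : x ∈ S
  · obtain ⟨U, h, H, hxU, -⟩ := hS x hx Set.univ Filter.univ_mem
    exact ⟨U, h, H, hxU⟩
  · obtain ⟨ε, hε, hball⟩ := Metric.isOpen_iff.1 hcl.isOpen_compl x hx
    refine ⟨Metric.ball x ε, fun _ => 1, ⟨Metric.isOpen_ball, continuousOn_const, ?_, ?_, ?_, ?_,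
      ?_⟩, Metric.mem_ball_self hε⟩
    · intro y hy
      simpa using hball hy
    · simp only [zero_lt_one, and_true]
      exact (convex_ball x ε).isPreconnected
    · simp [not_lt.2 (zero_le_one' ℝ), isPreconnected_empty]
    · intro y hy hyS; exact absurd hyS (hball hy)
    · intro y hy hyS; exact absurd hyS (hball hy)

/-- A compact locally flat hypersurface of a ball has a globally defined two-colouring of its
complement in the ball, which changes across the hypersurface. -/
theorem IsLocallyFlat.exists_primitive [ProperSpace E] (hS : IsLocallyFlat S) (hc : IsCompact S)
    (R : ℝ) (hR : S ⊆ Metric.ball 0 R) :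
    ∃ c : E → ZMod 2, ContinuousOn c (Metric.closedBall 0 R \ S) ∧
      ∀ p ∈ S, ∀ U h, IsFlatNhd S U h → p ∈ U → ∃ N ∈ 𝓝 p, ∀ z ∈ N, ∀ w ∈ N, z ∉ S → w ∉ S →
        c z + c w = side h z + side h w := by
  choose U h H hmem using hS.exists_isFlatNhd hc.isClosed
  obtain ⟨δ, hδ, hleb⟩ := lebesgue_number_lemma_of_metric (isCompact_closedBall (0 : E) R)
    (fun i => (H i).isOpen) (fun x _ => Set.mem_iUnion.2 ⟨x, hmem x⟩)
  have hleb' : ∀ x, ∃ i, ‖x‖ ≤ R → Metric.ball x δ ⊆ U i := by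
    intro x
    by_cases hx : ‖x‖ ≤ R
    · obtain ⟨i, hi⟩ := hleb x (by simpa using hx)
      exact ⟨i, fun _ => hi⟩
    · exact ⟨x, fun h => absurd h hx⟩
  choose idx hidx using hleb'
  have hcomp : ∀ x, ∃ y, y ∉ S ∧ dist y x < δ / 8 ∧ (x ∉ S → y = x) := by
    intro x
    by_cases hx : x ∈ S
    · obtain ⟨y, hy, hxy⟩ := Metric.dense_iff.1 hS.dense_compl x (δ / 8) (by positivity)
      exact ⟨y, hxy, hy, fun h => absurd hx h⟩
    · exact ⟨x, hx, by simpa using by positivity, fun _ => rfl⟩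
  -- `r x` is a point off `S` close to `x`, needed because the cocycle has to be defined on `S` too
  choose r hrS hrd hr using hcomp
  have hball : ∀ x y, dist x y < δ / 4 → r y ∈ Metric.ball x (δ / 2) := by
    intro x y hxy
    rw [Metric.mem_ball]
    linarith [dist_triangle (r y) y x, hrd y, dist_comm x y]
  have hpre : ∀ x : E, ∀ ε, IsPreconnected (Metric.ball x ε) := fun x ε =>
    (convex_ball x ε).isPreconnected
  have hsubball : ∀ x y : E, dist x y < δ / 4 → Metric.ball x (δ / 2) ⊆ Metric.ball y δ := by
    intro x y hxy
    exact Metric.ball_subset_ball' (by linarith)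
  obtain ⟨c, hcs⟩ := exists_primitive_of_cocycle R (δ / 4) (by positivity)
    (fun x y => side (h (idx x)) (r x) + side (h (idx x)) (r y)) (by
      intro x y z hx hy hz hxy hyz hxz
      obtain ⟨k, hk⟩ := (H (idx x)).exists_side_add_side_eq hS (H (idx y)) (hpre x (δ / 2))
        ((Metric.ball_subset_ball (by linarith)).trans (hidx x hx))
        ((hsubball x y hxy).trans (hidx y hy))
      have e1 := hk (r y) (hball x y hxy) (hrS y)
      have e2 := hk (r z) (hball x z hxz) (hrS z)
      generalize side (h (idx x)) (r x) = a at *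
      generalize side (h (idx x)) (r y) = b at *
      generalize side (h (idx x)) (r z) = d at *
      generalize side (h (idx y)) (r y) = e at *
      generalize side (h (idx y)) (r z) = f at *
      clear * - e1 e2
      revert a b d e f k; decide)
  refine ⟨c, ?_, ?_⟩
  · intro x hx
    have hxR : ‖x‖ ≤ R := by simpa using hx.1
    have hev : ∀ᶠ z in 𝓝[Metric.closedBall 0 R \ S] x, c z = c x := by
      filter_upwards [self_mem_nhdsWithin,
        mem_nhdsWithin_of_mem_nhds (Metric.ball_mem_nhds x (show 0 < δ / 4 / 2 by positivity)),
        mem_nhdsWithin_of_mem_nhds ((H (idx x)).side_eventually_const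
          (hidx x hxR (Metric.mem_ball_self hδ)) hx.2)] with z hz hzd hzs
      have := hcs x z hxR (by simpa using hz.1) (by rwa [dist_comm])
      rw [hr x hx.2, hr z hz.2, hzs] at this
      generalize side (h (idx x)) x = a at *
      generalize c x = b at *
      generalize c z = d at *
      clear * - this
      revert a b d; decide
    exact (continuousWithinAt_const (b := c x)).congr_of_eventuallyEq hev rfl
  · intro p hp V g HV hpV
    obtain ⟨ε, hε, hεV⟩ := Metric.isOpen_iff.1
      ((HV.isOpen.inter (Metric.isOpen_ball (x := (0 : E)) (ε := R)))) p ⟨hpV, hR hp⟩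
    refine ⟨Metric.ball p (min ε (δ / 16)), Metric.ball_mem_nhds _ (by positivity), ?_⟩
    intro z hz w hw hzS hwS
    rw [Metric.mem_ball] at hz hw
    have hz1 := hz.trans_le (min_le_left _ _)
    have hw1 := hw.trans_le (min_le_left _ _)
    have hz2 := hz.trans_le (min_le_right _ _)
    have hw2 := hw.trans_le (min_le_right _ _)
    have hzR : ‖z‖ ≤ R := by simpa using (Metric.ball_subset_closedBall (hεV hz1).2)
    have hwR : ‖w‖ ≤ R := by simpa using (Metric.ball_subset_closedBall (hεV hw1).2)
    rw [hcs z w hzR hwR (by linarith [dist_triangle z p w, dist_comm p w]), hr z hzS, hr w hwS]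
    obtain ⟨k, hk⟩ := (H (idx z)).exists_side_add_side_eq hS HV (hpre p (min ε (δ / 16)))
      ((Metric.ball_subset_ball' (by
        linarith [min_le_right ε (δ / 16), dist_comm p z])).trans (hidx z hzR))
      (fun y hy => (hεV (Metric.ball_subset_ball (min_le_left _ _) hy)).1)
    have e1 := hk z hz hzS
    have e2 := hk w hw hwS
    generalize side (h (idx z)) z = a at *
    generalize side (h (idx z)) w = b at *
    generalize side g z = d at *
    generalize side g w = e at *
    clear * - e1 e2
    revert a b d e k; decide

/-- The two sides of a compact locally flat hypersurface lie in different components of its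
complement. -/
theorem IsFlatNhd.connectedComponentIn_ne [ProperSpace E] (hS : IsLocallyFlat S)
    (hc : IsCompact S) {U : Set E} {h : E → ℝ} (H : IsFlatNhd S U h) {p x y : E} (hpU : p ∈ U)
    (hpS : p ∈ S) (hx : x ∈ U) (hhx : 0 < h x) (hy : y ∈ U) (hhy : h y < 0) :
    connectedComponentIn Sᶜ x ≠ connectedComponentIn Sᶜ y := by
  intro heq
  obtain ⟨R, hR0, hR⟩ := hc.isBounded.subset_ball_lt 0 0
  obtain ⟨c, hcont, hjump⟩ := hS.exists_primitive hc R hR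
  obtain ⟨N, hN, hNc⟩ := hjump p hpS U h H hpU
  obtain ⟨N', hN'N, hN'o, hpN'⟩ :=
    mem_nhds_iff.1 (Filter.inter_mem hN (Metric.isOpen_ball.mem_nhds (hR hpS)))
  obtain ⟨z, hz, hzU⟩ := mem_closure_iff.1 (H.mem_closure_pos p hpU hpS) N' hN'o hpN'
  obtain ⟨w, hw, hwU⟩ := mem_closure_iff.1 (H.mem_closure_neg p hpU hpS) N' hN'o hpN'
  have hzS := H.disjoint_pos hzU
  have hwS := H.disjoint_neg hwU
  have hzx : z ∈ connectedComponentIn Sᶜ x :=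
    H.preconn_pos.subset_connectedComponentIn ⟨hx, hhx⟩ H.disjoint_pos hzU
  have hwx : w ∈ connectedComponentIn Sᶜ x := heq ▸
    H.preconn_neg.subset_connectedComponentIn ⟨hy, hhy⟩ H.disjoint_neg hwU
  -- the radial retraction onto the closed ball maps the complement of `S` to itself
  let ρ : E → E := fun v => (R / max R ‖v‖) • v
  have hmax : ∀ v : E, 0 < max R ‖v‖ := fun v => hR0.trans_le (le_max_left _ _)
  have hρc : Continuous ρ := by
    refine Continuous.smul (Continuous.div continuous_const (by fun_prop) ?_) continuous_id
    exact fun v => (hmax v).ne'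
  have hρid : ∀ v, ‖v‖ ≤ R → ρ v = v := by
    intro v hv; simp [ρ, max_eq_left hv, hR0.ne']
  have hρn : ∀ v, R ≤ ‖v‖ → ‖ρ v‖ = R := by
    intro v hv
    simp only [ρ, max_eq_right hv, norm_smul, norm_div, norm_norm]
    rw [Real.norm_eq_abs, abs_of_pos hR0]
    exact div_mul_cancel₀ _ (hR0.trans_le hv).ne'
  have hρmaps : Set.MapsTo ρ Sᶜ (Metric.closedBall 0 R \ S) := by
    intro v hv
    rcases le_total ‖v‖ R with h1 | h1
    · rw [hρid v h1]; exact ⟨by simpa using h1, hv⟩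
    · refine ⟨by simpa using (hρn v h1).le, fun hS' => ?_⟩
      have := hR hS'
      rw [mem_ball_zero_iff, hρn v h1] at this
      exact lt_irrefl _ this
  have hconst : c (ρ z) = c (ρ w) :=
    (isPreconnected_connectedComponentIn (F := Sᶜ) (x := x)).constant
      (f := fun v => c (ρ v)) ((hcont.comp hρc.continuousOn hρmaps).mono
        (connectedComponentIn_subset _ _))
      hzx hwx
  have hnz : ‖z‖ ≤ R := by simpa using (Metric.ball_subset_closedBall (hN'N hz).2)
  have hnw : ‖w‖ ≤ R := by simpa using (Metric.ball_subset_closedBall (hN'N hw).2)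
  rw [hρid z hnz, hρid w hnw] at hconst
  have := hNc z (hN'N hz).1 w (hN'N hw).1 hzS hwS
  rw [hconst, side, side, if_pos hzU.2, if_neg (not_lt.2 hwU.2.le)] at this
  generalize c w = a at this
  clear * - this
  revert a; decide

theorem isPreconnected_compl_closedBall (hrank : 1 < Module.rank ℝ E) {R : ℝ} (hR : 0 ≤ R) :
    IsPreconnected (Metric.closedBall (0 : E) R)ᶜ := by
  have h0 := (isConnected_compl_singleton_of_one_lt_rank hrank (0 : E)).isPreconnected
  have him : (fun v : E => ((R + ‖v‖) / ‖v‖) • v) '' {0}ᶜ = (Metric.closedBall (0 : E) R)ᶜ := by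
    ext w
    simp only [Set.mem_image, Set.mem_compl_iff, Set.mem_singleton_iff, Metric.mem_closedBall,
      dist_zero_right, not_le]
    constructor
    · rintro ⟨v, hv, rfl⟩
      have hv' : 0 < ‖v‖ := norm_pos_iff.2 hv
      rw [norm_smul, Real.norm_eq_abs, abs_of_nonneg (by positivity), div_mul_cancel₀ _ hv'.ne']
      linarith
    · intro hw
      have hw' : 0 < ‖w‖ := hR.trans_lt hw
      have hpos : 0 < (‖w‖ - R) / ‖w‖ := div_pos (by linarith) hw'
      refine ⟨((‖w‖ - R) / ‖w‖) • w, smul_ne_zero hpos.ne' (norm_pos_iff.1 hw'), ?_⟩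
      have hn : ‖((‖w‖ - R) / ‖w‖) • w‖ = ‖w‖ - R := by
        rw [norm_smul, Real.norm_eq_abs, abs_of_pos hpos, div_mul_cancel₀ _ hw'.ne']
      rw [hn, smul_smul]
      have : (R + (‖w‖ - R)) / (‖w‖ - R) * ((‖w‖ - R) / ‖w‖) = 1 := by
        have : ‖w‖ - R ≠ 0 := by linarith
        field_simp; ring
      rw [this, one_smul]
  rw [← him]
  refine h0.image _ (ContinuousOn.smul (ContinuousOn.div (by fun_prop) (by fun_prop) ?_)
    continuousOn_id)
  exact fun v hv => norm_ne_zero_iff.2 hv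

/-- The closure of a component of the complement of a connected compact locally flat
hypersurface contains the whole hypersurface. -/
theorem IsLocallyFlat.subset_closure_component [FiniteDimensional ℝ E] (hS : IsLocallyFlat S)
    (hc : IsCompact S) (hconn : IsConnected S) {x : E} (hx : x ∉ S) :
    S ⊆ closure (connectedComponentIn Sᶜ x) := by
  set C := connectedComponentIn Sᶜ x with hC
  have hCo : IsOpen C := hc.isClosed.isOpen_compl.connectedComponentIn
  have hCS : C ⊆ Sᶜ := connectedComponentIn_subset _ _
  have hxC : x ∈ C := mem_connectedComponentIn hx
  have hmeet : (S ∩ closure C).Nonempty := by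
    by_contra hemp
    have hcl : IsClosed C := by
      refine isClosed_of_closure_subset fun q hq => ?_
      have hqS : q ∉ S := fun h => hemp ⟨q, h, hq⟩
      have hqo : IsOpen (connectedComponentIn Sᶜ q) := hc.isClosed.isOpen_compl.connectedComponentIn
      obtain ⟨y, hyq, hyC⟩ := mem_closure_iff.1 hq _ hqo (mem_connectedComponentIn hqS)
      have e1 := connectedComponentIn_eq hyq
      have e2 := connectedComponentIn_eq hyC
      rw [hC, e2, ← e1]
      exact mem_connectedComponentIn hqS
    have huniv : C = Set.univ := IsClopen.eq_univ ⟨hcl, hCo⟩ ⟨x, hxC⟩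
    obtain ⟨q, hq⟩ := hconn.nonempty
    exact hCS (huniv ▸ Set.mem_univ q) hq
  -- the points of `S` adherent to `C` form a subset of `S` which is both closed and open
  have hloc : ∀ q ∈ S, q ∈ closure C → ∃ U : Set E, IsOpen U ∧ q ∈ U ∧ S ∩ U ⊆ closure C := by
    intro q hq hqC
    obtain ⟨U, h, H, hqU, -⟩ := hS q hq Set.univ Filter.univ_mem
    obtain ⟨y, hyU, hyC⟩ := mem_closure_iff.1 hqC U H.isOpen hqU
    refine ⟨U, H.isOpen, hqU, ?_⟩
    have hyS := hCS hyC
    have e2 := connectedComponentIn_eq hyC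
    rcases lt_trichotomy (h y) 0 with h0 | h0 | h0
    · have : {x | x ∈ U ∧ h x < 0} ⊆ C := by
        rw [hC, e2]
        exact H.preconn_neg.subset_connectedComponentIn ⟨hyU, h0⟩ H.disjoint_neg
      exact fun z hz => closure_mono this (H.mem_closure_neg z hz.2 hz.1)
    · exact absurd ((H.mem_iff y hyU).2 h0) hyS
    · have : {x | x ∈ U ∧ 0 < h x} ⊆ C := by
        rw [hC, e2]
        exact H.preconn_pos.subset_connectedComponentIn ⟨hyU, h0⟩ H.disjoint_pos
      exact fun z hz => closure_mono this (H.mem_closure_pos z hz.2 hz.1)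
  let O : Set E := ⋃₀ {U | IsOpen U ∧ S ∩ U ⊆ closure C}
  have hO : IsOpen O := isOpen_sUnion fun U hU => hU.1
  by_contra hnot
  obtain ⟨q, hqS, hqC⟩ := Set.not_subset.1 hnot
  obtain ⟨p, hpS, hpC⟩ := hmeet
  obtain ⟨U, hUo, hpU, hU⟩ := hloc p hpS hpC
  obtain ⟨z, hzS, ⟨W, hW, hzW⟩, hzC⟩ := hconn.isPreconnected O (closure C)ᶜ hO
    isClosed_closure.isOpen_compl (fun z hz => by
      by_cases hzC : z ∈ closure C
      · obtain ⟨U, hUo, hpU, hU⟩ := hloc z hz hzC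
        exact Or.inl ⟨U, ⟨hUo, hU⟩, hpU⟩
      · exact Or.inr hzC) ⟨p, hpS, U, ⟨hUo, hU⟩, hpU⟩ ⟨q, hqS, hqC⟩
  exact hzC (hW.2 ⟨hzS, hzW⟩)

/-- **Jordan–Brouwer separation** for a connected compact locally flat hypersurface: locally, one
of its sides lies in unbounded components of the complement and the other one in bounded
components. -/
theorem IsFlatNhd.bounded_unbounded [FiniteDimensional ℝ E] (hrank : 1 < Module.rank ℝ E)
    (hS : IsLocallyFlat S) (hc : IsCompact S) (hconn : IsConnected S) {U : Set E} {h : E → ℝ}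
    (H : IsFlatNhd S U h) {p : E} (hpU : p ∈ U) (hpS : p ∈ S) :
    ((∀ x ∈ U, 0 < h x → ¬ Bornology.IsBounded (connectedComponentIn Sᶜ x)) ∧
      ∀ x ∈ U, h x < 0 → Bornology.IsBounded (connectedComponentIn Sᶜ x)) ∨
    ((∀ x ∈ U, h x < 0 → ¬ Bornology.IsBounded (connectedComponentIn Sᶜ x)) ∧
      ∀ x ∈ U, 0 < h x → Bornology.IsBounded (connectedComponentIn Sᶜ x)) := by
  have : ProperSpace E := FiniteDimensional.proper ℝ E
  obtain ⟨R, hR0, hR⟩ := hc.isBounded.subset_closedBall_lt 0 0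
  have hpc := isPreconnected_compl_closedBall hrank hR0.le
  have hsub : (Metric.closedBall (0 : E) R)ᶜ ⊆ Sᶜ := Set.compl_subset_compl.2 hR
  have : Nontrivial E := by
    have := (zero_lt_one.trans hrank)
    exact rank_pos_iff_nontrivial.1 this
  obtain ⟨e, he⟩ := NormedSpace.exists_lt_norm ℝ E R
  have heS : e ∈ (Metric.closedBall (0 : E) R)ᶜ := by simpa using he
  have hsubC : (Metric.closedBall (0 : E) R)ᶜ ⊆ connectedComponentIn Sᶜ e :=
    hpc.subset_connectedComponentIn heS hsub
  have hunb : ¬ Bornology.IsBounded (connectedComponentIn Sᶜ e) := by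
    intro hb
    obtain ⟨r, hr⟩ := hb.subset_closedBall 0
    obtain ⟨v, hv⟩ := NormedSpace.exists_lt_norm ℝ E (max R r)
    have h1 := hsubC (show v ∈ (Metric.closedBall (0 : E) R)ᶜ by
      simpa using (le_max_left _ _).trans_lt hv)
    have h2 := hr h1
    rw [mem_closedBall_zero_iff] at h2
    exact absurd (h2.trans (le_max_right R r)) (not_le.2 hv)
  have hbdd : ∀ x, x ∉ S → connectedComponentIn Sᶜ x ≠ connectedComponentIn Sᶜ e →
      Bornology.IsBounded (connectedComponentIn Sᶜ x) := by
    intro x hx hne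
    refine (Metric.isBounded_closedBall (x := (0 : E)) (r := R)).subset fun y hy => ?_
    by_contra hyR
    exact hne ((connectedComponentIn_eq hy).trans (connectedComponentIn_eq (hsubC hyR)).symm)
  have hposeq : ∀ x ∈ U, ∀ y ∈ U, 0 < h x → 0 < h y →
      connectedComponentIn Sᶜ x = connectedComponentIn Sᶜ y := fun x hx y hy hhx hhy =>
    connectedComponentIn_eq
      (H.preconn_pos.subset_connectedComponentIn ⟨hx, hhx⟩ H.disjoint_pos ⟨hy, hhy⟩)
  have hnegeq : ∀ x ∈ U, ∀ y ∈ U, h x < 0 → h y < 0 →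
      connectedComponentIn Sᶜ x = connectedComponentIn Sᶜ y := fun x hx y hy hhx hhy =>
    connectedComponentIn_eq
      (H.preconn_neg.subset_connectedComponentIn ⟨hx, hhx⟩ H.disjoint_neg ⟨hy, hhy⟩)
  have hne : ∀ x ∈ U, ∀ y ∈ U, 0 < h x → h y < 0 →
      connectedComponentIn Sᶜ x ≠ connectedComponentIn Sᶜ y := fun x hx y hy hhx hhy =>
    H.connectedComponentIn_ne hS hc hpU hpS hx hhx hy hhy
  obtain ⟨y, hyU, hye⟩ := mem_closure_iff.1
    (hS.subset_closure_component hc hconn (hsub heS) hpS) U H.isOpen hpU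
  have hyS : y ∉ S := connectedComponentIn_subset _ _ hye
  have hey := connectedComponentIn_eq hye
  rcases lt_trichotomy (h y) 0 with h0 | h0 | h0
  · right
    refine ⟨fun x hx hhx => ?_, fun x hx hhx => hbdd x (H.disjoint_pos ⟨hx, hhx⟩) ?_⟩
    · rw [hnegeq x hx y hyU hhx h0, ← hey]; exact hunb
    · rw [hey]; exact hne x hx y hyU hhx h0
  · exact absurd ((H.mem_iff y hyU).2 h0) hyS
  · left
    refine ⟨fun x hx hhx => ?_, fun x hx hhx => hbdd x (H.disjoint_neg ⟨hx, hhx⟩) ?_⟩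
    · rw [hposeq x hx y hyU hhx h0, ← hey]; exact hunb
    · rw [hey]; exact (hne y hyU x hx h0 hhx).symm

end

/-! ### Adapted charts of an embedded surface -/

namespace IsLocalParam

variable {S : Set E3} {φ : E2 → E3} {V : Set E2}

theorem mono (h : IsLocalParam S φ V) {V' : Set E2} (hV' : IsOpen V') (hsub : V' ⊆ V) :
    IsLocalParam S φ V' where
  isOpen := hV'
  smooth := h.smooth.mono hsub
  immersion y hy := h.immersion y (hsub hy)
  injOn := h.injOn.mono hsub
  openMap U hU hUo := h.openMap U (hU.trans hsub) hUo

theorem mem (h : IsLocalParam S φ V) {y : E2} (hy : y ∈ V) : φ y ∈ S := by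
  obtain ⟨W, -, hW⟩ := h.openMap V subset_rfl h.isOpen
  have : φ y ∈ S ∩ W := hW ▸ Set.mem_image_of_mem φ hy
  exact this.1

theorem contDiffAt (h : IsLocalParam S φ V) {y : E2} (hy : y ∈ V) : ContDiffAt ℝ ∞ φ y :=
  h.smooth.contDiffAt (h.isOpen.mem_nhds hy)

theorem differentiableAt (h : IsLocalParam S φ V) {y : E2} (hy : y ∈ V) :
    DifferentiableAt ℝ φ y :=
  (h.contDiffAt hy).differentiableAt (by simp)

end IsLocalParam

/-- A local parametrization `φ` of `S` on the ball `B(y₀, r)`, extending to a neighbourhood of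
the closed ball, together with an open set `U` of `ℝ³`, a defining function `h` of `S` in `U`
with non-vanishing differential, and a map `P` on `U` which inverts `φ` on `S ∩ U`. -/
structure IsSurfaceChart (S : Set E3) (φ : E2 → E3) (y₀ : E2) (r : ℝ) (U : Set E3)
    (P : E3 → E2) (h : E3 → ℝ) : Prop where
  exists_extension : ∃ V, IsLocalParam S φ V ∧ Metric.closedBall y₀ r ⊆ V
  flat : IsFlatNhd S U h
  contDiffOn_proj : ContDiffOn ℝ 2 P U
  contDiffOn_defining : ContDiffOn ℝ 2 h U
  fderiv_ne_zero : ∀ x ∈ U, fderiv ℝ h x ≠ 0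
  proj_mem : ∀ x ∈ U, x ∈ S → P x ∈ Metric.ball y₀ r
  apply_proj : ∀ x ∈ U, x ∈ S → φ (P x) = x
  map_mem : ∀ y ∈ Metric.ball y₀ r, φ y ∈ U
  proj_apply : ∀ y ∈ Metric.ball y₀ r, P (φ y) = y

/-- Charts exist around every point: translating the surface along a transverse vector `n` gives
local coordinates `(y, t) ↦ φ y + t n` of space in which the surface is `{t = 0}`. -/
theorem IsLocalParam.exists_isSurfaceChart {S : Set E3} {φ : E2 → E3} {V : Set E2}
    (hφ : IsLocalParam S φ V) {y₀ : E2} (hy₀ : y₀ ∈ V) {N : Set E3} (hN : N ∈ 𝓝 (φ y₀)) :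
    ∃ (r : ℝ) (U : Set E3) (P : E3 → E2) (h : E3 → ℝ), 0 < r ∧ IsSurfaceChart S φ y₀ r U P h ∧
      φ y₀ ∈ U ∧ U ⊆ N := by
  set D := fderiv ℝ φ y₀ with hD
  have hDinj : Function.Injective D := hφ.immersion y₀ hy₀
  obtain ⟨n, hn⟩ : ∃ n : E3, n ∉ LinearMap.range (D : E2 →ₗ[ℝ] E3) := by
    by_contra! hall
    have htop : LinearMap.range (D : E2 →ₗ[ℝ] E3) = ⊤ := eq_top_iff.2 fun x _ => hall x
    have h1 := LinearMap.finrank_range_le (D : E2 →ₗ[ℝ] E3)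
    rw [htop, finrank_top] at h1
    simp at h1
  let L : E2 × ℝ →L[ℝ] E3 :=
    D.comp (ContinuousLinearMap.fst ℝ E2 ℝ) + (ContinuousLinearMap.snd ℝ E2 ℝ).smulRight n
  have hLapp : ∀ v : E2 × ℝ, L v = D v.1 + v.2 • n := fun v => rfl
  have hLinj : Function.Injective L := by
    rw [injective_iff_map_eq_zero]
    rintro ⟨a, t⟩ h0
    rw [hLapp] at h0
    simp only at h0
    have ht : t = 0 := by
      by_contra ht
      refine hn ⟨-(t⁻¹ • a), ?_⟩
      have : t • n = -D a := by rw [eq_neg_iff_add_eq_zero, add_comm]; exact h0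
      rw [map_neg, map_smul]
      change -(t⁻¹ • D a) = n
      rw [← smul_neg, ← this, smul_smul, inv_mul_cancel₀ ht, one_smul]
    subst ht
    have ha : a = 0 := (injective_iff_map_eq_zero D).1 hDinj a (by simpa using h0)
    simp [ha]
  let Le : (E2 × ℝ) ≃L[ℝ] E3 := (LinearEquiv.ofInjectiveOfFinrankEq (L : E2 × ℝ →ₗ[ℝ] E3) hLinj
    (by simp)).toContinuousLinearEquiv
  have hLe : (Le : E2 × ℝ →L[ℝ] E3) = L := by ext v <;> rfl
  let Φ : E2 × ℝ → E3 := fun z => φ z.1 + z.2 • n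
  have hΦ0 : Φ (y₀, 0) = φ y₀ := by simp [Φ]
  have hΦc : ∀ z : E2 × ℝ, z.1 ∈ V → ContDiffAt ℝ ∞ Φ z := fun z hz =>
    ((hφ.contDiffAt hz).comp z contDiffAt_fst).add (contDiffAt_snd.smul contDiffAt_const)
  have hΦd : HasFDerivAt Φ (Le : E2 × ℝ →L[ℝ] E3) (y₀, 0) := by
    rw [hLe]
    have h1 : HasFDerivAt (fun z : E2 × ℝ => φ z.1) (D.comp (ContinuousLinearMap.fst ℝ E2 ℝ))
        (y₀, 0) :=
      HasFDerivAt.comp (y₀, (0 : ℝ)) (hφ.differentiableAt hy₀).hasFDerivAt hasFDerivAt_fst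
    have h2 : HasFDerivAt (fun z : E2 × ℝ => z.2 • n)
        ((ContinuousLinearMap.snd ℝ E2 ℝ).smulRight n) (y₀, 0) :=
      hasFDerivAt_snd.smul_const n
    exact h1.add h2
  have hΦ2 : ContDiffAt ℝ 2 Φ (y₀, 0) := (hΦc _ hy₀).of_le (WithTop.coe_le_coe.2 le_top)
  let e := hΦ2.toOpenPartialHomeomorph Φ hΦd (by simp)
  have he : ∀ z, e z = Φ z := fun z => rfl
  have he0 : (y₀, 0) ∈ e.source := hΦ2.mem_toOpenPartialHomeomorph_source hΦd (by simp)
  have hsymm : ContDiffAt ℝ 2 e.symm (φ y₀) := by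
    rw [← hΦ0]; exact hΦ2.to_localInverse hΦd (by simp)
  have hVn : V ∈ 𝓝 y₀ := hφ.isOpen.mem_nhds hy₀
  -- a first radius, for the domain of the inverse
  have hsrc : e.source ∩ {z | z.1 ∈ V} ∈ 𝓝 (y₀, (0 : ℝ)) :=
    Filter.inter_mem (e.open_source.mem_nhds he0) (continuousAt_fst.preimage_mem_nhds hVn)
  obtain ⟨r₀, hr₀, hball₀⟩ := Metric.mem_nhds_iff.1 hsrc
  have hbV₀ : Metric.ball y₀ r₀ ⊆ V := fun y hy =>
    (hball₀ (show (y, (0 : ℝ)) ∈ _ by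
      rw [Metric.mem_ball, Prod.dist_eq]; simpa [hr₀] using hy)).2
  obtain ⟨W, hWo, hW⟩ := hφ.openMap (Metric.ball y₀ r₀) hbV₀ Metric.isOpen_ball
  have hpW : φ y₀ ∈ W := by
    have : φ y₀ ∈ S ∩ W := hW ▸ Set.mem_image_of_mem φ (Metric.mem_ball_self hr₀)
    exact this.2
  -- a second radius, such that the image lies in all prescribed neighbourhoods
  have htgt : {x | x ∈ W ∧ x ∈ N ∧ ContDiffAt ℝ 2 e.symm x} ∈ 𝓝 (Φ (y₀, 0)) := by
    rw [hΦ0]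
    exact Filter.inter_mem (hWo.mem_nhds hpW)
      (Filter.inter_mem hN (hsymm.eventually (by simp)))
  obtain ⟨r₁, hr₁, hball₁⟩ :=
    Metric.mem_nhds_iff.1 ((hΦc (y₀, 0) hy₀).continuousAt.preimage_mem_nhds htgt)
  let r := min r₀ r₁ / 2
  have hr : 0 < r := by positivity
  have hrr₀ : r < r₀ := (half_lt_self (lt_min hr₀ hr₁)).trans_le (min_le_left _ _)
  have hrr₁ : r < r₁ := (half_lt_self (lt_min hr₀ hr₁)).trans_le (min_le_right _ _)
  set B := Metric.ball (y₀, (0 : ℝ)) r with hB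
  have hmemB : ∀ y t, (y, t) ∈ B ↔ y ∈ Metric.ball y₀ r ∧ |t| < r := by
    intro y t
    rw [hB, Metric.mem_ball, Prod.dist_eq, max_lt_iff, Metric.mem_ball, Real.dist_eq, sub_zero]
  have hBsrc : B ⊆ e.source := fun z hz =>
    (hball₀ (Metric.ball_subset_ball hrr₀.le hz)).1
  have hBV : ∀ z ∈ B, z.1 ∈ V := fun z hz => (hball₀ (Metric.ball_subset_ball hrr₀.le hz)).2
  have hBt : ∀ z ∈ B, Φ z ∈ W ∧ Φ z ∈ N ∧ ContDiffAt ℝ 2 e.symm (Φ z) := fun z hz =>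
    hball₁ (Metric.ball_subset_ball hrr₁.le hz)
  have hleft : ∀ z ∈ B, e.symm (Φ z) = z := fun z hz => e.left_inv (hBsrc hz)
  let U := Φ '' B
  have hUo : IsOpen U := e.isOpen_image_of_subset_source Metric.isOpen_ball hBsrc
  have hUc : ∀ x ∈ U, ContDiffAt ℝ 2 e.symm x := by
    rintro _ ⟨z, hz, rfl⟩; exact (hBt z hz).2.2
  have hsurf : ∀ z ∈ B, Φ z ∈ S → z.2 = 0 := by
    intro z hz hzS
    have : Φ z ∈ φ '' Metric.ball y₀ r₀ := hW ▸ ⟨hzS, (hBt z hz).1⟩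
    obtain ⟨y, hy, hyz⟩ := this
    have hysrc : (y, (0 : ℝ)) ∈ e.source :=
      (hball₀ (by rw [Metric.mem_ball, Prod.dist_eq]; simpa [hr₀] using hy)).1
    have : (y, (0 : ℝ)) = z := e.injOn hysrc (hBsrc hz) (by
      rw [he, he, ← hyz]; simp [Φ])
    rw [← this]
  have hcontΦ : ContinuousOn Φ B := fun z hz => (hΦc z (hBV z hz)).continuousAt.continuousWithinAt
  have hside : ∀ (p : ℝ → Prop), {x | x ∈ U ∧ p (e.symm x).2} = Φ '' {z | z ∈ B ∧ p z.2} := by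
    intro p; ext x; constructor
    · rintro ⟨⟨z, hz, rfl⟩, hp⟩
      rw [hleft z hz] at hp
      exact ⟨z, ⟨hz, hp⟩, rfl⟩
    · rintro ⟨z, ⟨hz, hp⟩, rfl⟩
      exact ⟨⟨z, hz, rfl⟩, by rwa [hleft z hz]⟩
  have hpre : ∀ (p : ℝ → Prop), Convex ℝ {t | p t} →
      IsPreconnected {x | x ∈ U ∧ p (e.symm x).2} := by
    intro p hp
    rw [hside p]
    refine IsPreconnected.image ?_ _ (hcontΦ.mono fun z hz => hz.1)
    exact ((convex_ball (y₀, (0 : ℝ)) r).inter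
      (hp.linear_preimage (LinearMap.snd ℝ E2 ℝ))).isPreconnected
  have hcl : ∀ (p : ℝ → Prop), (∃ᶠ t in 𝓝 (0 : ℝ), p t) → ∀ x ∈ U, x ∈ S →
      x ∈ closure {x | x ∈ U ∧ p (e.symm x).2} := by
    rintro p hp _ ⟨z, hz, rfl⟩ hzS
    have hz2 := hsurf z hz hzS
    rw [mem_closure_iff_frequently]
    have hct : ContinuousAt (fun t : ℝ => Φ (z.1, t)) 0 := by
      have : (z.1, (0 : ℝ)) = z := by rw [← hz2]
      exact ContinuousAt.comp (f := fun t : ℝ => (z.1, t)) (g := Φ)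
        (by rw [this]; exact (hΦc z (hBV z hz)).continuousAt) (by fun_prop)
    have hev : ∀ᶠ t : ℝ in 𝓝 0, (z.1, t) ∈ B := by
      have h1 := (hmemB z.1 z.2).1 hz
      filter_upwards [Metric.ball_mem_nhds (0 : ℝ) hr] with t ht
      rw [hmemB]; exact ⟨h1.1, by simpa using ht⟩
    have h2 : ∃ᶠ t in 𝓝 (0 : ℝ), Φ (z.1, t) ∈ {x | x ∈ U ∧ p (e.symm x).2} := by
      refine (hp.and_eventually hev).mono fun t ht => ?_
      exact ⟨⟨_, ht.2, rfl⟩, by rw [hleft _ ht.2]; exact ht.1⟩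
    have h3 : Filter.Tendsto (fun t : ℝ => Φ (z.1, t)) (𝓝 0) (𝓝 (Φ z)) := by
      have : Φ z = Φ (z.1, 0) := by rw [← hz2]
      rw [this]; exact hct
    exact h3.frequently h2
  refine ⟨r, U, fun x => (e.symm x).1, fun x => (e.symm x).2, hr, ⟨⟨V, hφ, ?_⟩, ⟨hUo, ?_, ?_, ?_,
    ?_, ?_, ?_⟩, ?_, ?_, ?_, ?_, ?_, ?_, ?_⟩, ?_, ?_⟩
  · exact (Metric.closedBall_subset_ball hrr₀).trans hbV₀
  · exact fun x hx => (hUc x hx).continuousAt.snd.continuousWithinAt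
  · rintro _ ⟨z, hz, rfl⟩
    rw [hleft z hz]
    refine ⟨hsurf z hz, fun h0 => ?_⟩
    have : Φ z = φ z.1 := by simp [Φ, h0]
    rw [this]; exact hφ.mem (hBV z hz)
  · exact hpre (fun t => 0 < t) (convex_Ioi 0)
  · exact hpre (fun t => t < 0) (convex_Iio 0)
  · exact hcl (fun t => 0 < t) (by
      have : ∃ᶠ t in 𝓝[>] (0 : ℝ), 0 < t :=
        Filter.Eventually.frequently self_mem_nhdsWithin
      exact this.filter_mono nhdsWithin_le_nhds)
  · exact hcl (fun t => t < 0) (by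
      have : ∃ᶠ t in 𝓝[<] (0 : ℝ), t < 0 :=
        Filter.Eventually.frequently self_mem_nhdsWithin
      exact this.filter_mono nhdsWithin_le_nhds)
  · exact fun x hx => (contDiffAt_fst.comp x (hUc x hx)).contDiffWithinAt
  · exact fun x hx => (contDiffAt_snd.comp x (hUc x hx)).contDiffWithinAt
  · rintro _ ⟨z, hz, rfl⟩ h0
    -- the derivative of `h` in the direction `n` is `1`
    have hd : HasFDerivAt (fun x => (e.symm x).2) (0 : E3 →L[ℝ] ℝ) (Φ z) := by
      rw [← h0]
      exact ((contDiffAt_snd.comp _ (hUc _ ⟨z, hz, rfl⟩)).differentiableAt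
        (by simp)).hasFDerivAt
    have hd2 := hd.comp z (((hΦc z (hBV z hz)).differentiableAt (by simp)).hasFDerivAt)
    have hd3 : HasFDerivAt (fun z : E2 × ℝ => z.2) (ContinuousLinearMap.snd ℝ E2 ℝ) z :=
      hasFDerivAt_snd
    have heq : (fun z : E2 × ℝ => z.2) =ᶠ[𝓝 z] (fun x => (e.symm x).2) ∘ Φ := by
      filter_upwards [Metric.isOpen_ball.mem_nhds hz] with w hw
      simp only [Function.comp_apply]; rw [hleft w hw]
    have := hd3.unique (hd2.congr_of_eventuallyEq heq)
    have h1 := congrArg (fun l : E2 × ℝ →L[ℝ] ℝ => l (0, 1)) this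
    simp at h1
  · rintro _ ⟨z, hz, rfl⟩ _
    rw [hleft z hz]; exact ((hmemB z.1 z.2).1 hz).1
  · rintro _ ⟨z, hz, rfl⟩ hzS
    rw [hleft z hz]
    simp [Φ, hsurf z hz hzS]
  · intro y hy
    exact ⟨(y, 0), (hmemB y 0).2 ⟨hy, by simpa using hr⟩, by simp [Φ]⟩
  · intro y hy
    have h1 := hleft (y, 0) ((hmemB y 0).2 ⟨hy, by simpa using hr⟩)
    have : Φ (y, 0) = φ y := by simp [Φ]
    rw [this] at h1
    rw [h1]
  · exact ⟨(y₀, 0), Metric.mem_ball_self hr, hΦ0⟩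
  · rintro _ ⟨z, hz, rfl⟩; exact (hBt z hz).2.1

theorem IsClosedEmbeddedSurface.isLocallyFlat {S : Set E3} (hS : IsClosedEmbeddedSurface S) :
    IsLocallyFlat S := by
  intro p hp N hN
  obtain ⟨φ, V, hφ, y, hy, rfl⟩ := hS.exists_param p hp
  obtain ⟨r, U, P, h, -, H, hU, hUN⟩ := hφ.exists_isSurfaceChart hy hN
  exact ⟨U, h, H.flat, hU, hUN⟩

namespace IsSurfaceChart

variable {S : Set E3} {φ : E2 → E3} {y₀ : E2} {r : ℝ} {U : Set E3} {P : E3 → E2} {h : E3 → ℝ}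

theorem isLocalParam (H : IsSurfaceChart S φ y₀ r U P h) :
    IsLocalParam S φ (Metric.ball y₀ r) := by
  obtain ⟨V, hV, hsub⟩ := H.exists_extension
  exact hV.mono Metric.isOpen_ball (Metric.ball_subset_closedBall.trans hsub)

theorem neg (H : IsSurfaceChart S φ y₀ r U P h) :
    IsSurfaceChart S φ y₀ r U P (fun x => -h x) where
  exists_extension := H.exists_extension
  flat := H.flat.neg
  contDiffOn_proj := H.contDiffOn_proj
  contDiffOn_defining := H.contDiffOn_defining.neg
  fderiv_ne_zero x hx := by rw [fderiv_fun_neg]; exact neg_ne_zero.2 (H.fderiv_ne_zero x hx)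
  proj_mem := H.proj_mem
  apply_proj := H.apply_proj
  map_mem := H.map_mem
  proj_apply := H.proj_apply

end IsSurfaceChart

/-- A chart whose defining function is positive in the exterior and negative in the interior of
the surface. -/
structure IsOrientedChart (S : Set E3) (φ : E2 → E3) (y₀ : E2) (r : ℝ) (U : Set E3)
    (P : E3 → E2) (h : E3 → ℝ) : Prop extends IsSurfaceChart S φ y₀ r U P h where
  mem_ext : ∀ x ∈ U, 0 < h x → x ∈ extRegion S
  mem_int : ∀ x ∈ U, h x < 0 → x ∈ intRegion S

/-- By Jordan–Brouwer separation, charts can be oriented. -/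
theorem IsClosedEmbeddedSurface.exists_isOrientedChart {S : Set E3}
    (hS : IsClosedEmbeddedSurface S) {p : E3} (hp : p ∈ S) {N : Set E3} (hN : N ∈ 𝓝 p) :
    ∃ (φ : E2 → E3) (y₀ : E2) (r : ℝ) (U : Set E3) (P : E3 → E2) (h : E3 → ℝ),
      IsOrientedChart S φ y₀ r U P h ∧ p ∈ U ∧ U ⊆ N := by
  obtain ⟨φ, V, hφ, y, hy, rfl⟩ := hS.exists_param p hp
  obtain ⟨r, U, P, h, -, H, hU, hUN⟩ := hφ.exists_isSurfaceChart hy hN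
  have hrank : 1 < Module.rank ℝ E3 := by
    rw [← Module.finrank_eq_rank]; simp
  rcases H.flat.bounded_unbounded hrank hS.isLocallyFlat hS.isCompact hS.isConnected hU hp with
    ⟨h1, h2⟩ | ⟨h1, h2⟩
  · exact ⟨φ, y, r, U, P, h, ⟨H, fun x hx hh => ⟨H.flat.disjoint_pos ⟨hx, hh⟩, h1 x hx hh⟩,
      fun x hx hh => ⟨H.flat.disjoint_neg ⟨hx, hh⟩, h2 x hx hh⟩⟩, hU, hUN⟩
  · refine ⟨φ, y, r, U, P, fun x => -h x, ⟨H.neg, fun x hx hh => ?_, fun x hx hh => ?_⟩, hU, hUN⟩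
    · rw [neg_pos] at hh
      exact ⟨H.flat.disjoint_neg ⟨hx, hh⟩, h1 x hx hh⟩
    · rw [neg_lt_zero] at hh
      exact ⟨H.flat.disjoint_pos ⟨hx, hh⟩, h2 x hx hh⟩

/-! ### The outgoing null normal -/

/-- For `‖g‖ < 1` and `k ≠ 0`, the unit vector `v` which has the same inner products as `g` with
all vectors orthogonal to `k`, and a positive inner product with `k`. With `g` and `k` the
gradients of `f` and of an oriented defining function, `(1, v)` is the outgoing null normal. -/
noncomputable def nullDir {E : Type*} [NormedAddCommGroup E] [InnerProductSpace ℝ E] (g k : E) :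
    E :=
  g - inner ℝ g (‖k‖⁻¹ • k) • (‖k‖⁻¹ • k) +
    Real.sqrt (1 - ‖g‖ ^ 2 + inner ℝ g (‖k‖⁻¹ • k) ^ 2) • (‖k‖⁻¹ • k)

theorem one_sub_norm_sq_add_pos {E : Type*} [NormedAddCommGroup E] {g : E} (hg : ‖g‖ < 1)
    (c : ℝ) : 0 < 1 - ‖g‖ ^ 2 + c ^ 2 := by
  have : ‖g‖ ^ 2 < 1 := by
    rw [sq_lt_one_iff_abs_lt_one, abs_norm]; exact hg
  linarith [sq_nonneg c]

section
variable {E : Type*} [NormedAddCommGroup E] [InnerProductSpace ℝ E] {g k v : E}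

theorem norm_inv_norm_smul_self (hk : k ≠ 0) : ‖‖k‖⁻¹ • k‖ = 1 := by
  rw [norm_smul, norm_inv, norm_norm, inv_mul_cancel₀ (norm_ne_zero_iff.2 hk)]

theorem norm_sub_inner_smul_add_smul_sq (n : E) (hn : ‖n‖ = 1) (c : ℝ) :
    ‖g - inner ℝ g n • n + c • n‖ ^ 2 = ‖g‖ ^ 2 - inner ℝ g n ^ 2 + c ^ 2 := by
  have hnn : inner ℝ n n = (1 : ℝ) := by rw [real_inner_self_eq_norm_sq, hn, one_pow]
  rw [← real_inner_self_eq_norm_sq, ← real_inner_self_eq_norm_sq]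
  simp only [inner_add_left, inner_add_right, inner_sub_left, inner_sub_right,
    real_inner_smul_left, real_inner_smul_right, hnn, real_inner_comm g n]
  ring

theorem norm_nullDir (hg : ‖g‖ < 1) (hk : k ≠ 0) : ‖nullDir g k‖ = 1 := by
  rw [← sq_eq_sq₀ (norm_nonneg _) zero_le_one, nullDir,
    norm_sub_inner_smul_add_smul_sq _ (norm_inv_norm_smul_self hk),
    Real.sq_sqrt (one_sub_norm_sq_add_pos hg _).le]
  ring

theorem inner_nullDir_of_inner_eq_zero {w : E} (hw : inner ℝ k w = 0) :
    inner ℝ (nullDir g k) w = inner ℝ g w := by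
  simp [nullDir, inner_add_left, inner_sub_left, real_inner_smul_left, hw]

theorem inner_nullDir_pos (hg : ‖g‖ < 1) (hk : k ≠ 0) : 0 < inner ℝ k (nullDir g k) := by
  have hk' : 0 < ‖k‖ := norm_pos_iff.2 hk
  have hs : 0 < Real.sqrt (1 - ‖g‖ ^ 2 + inner ℝ g (‖k‖⁻¹ • k) ^ 2) :=
    Real.sqrt_pos.2 (one_sub_norm_sq_add_pos hg _)
  have h1 : inner ℝ (‖k‖⁻¹ • k) (‖k‖⁻¹ • k) = (1 : ℝ) := by
    rw [real_inner_self_eq_norm_sq, norm_inv_norm_smul_self hk, one_pow]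
  have h2 : inner ℝ (‖k‖⁻¹ • k) (nullDir g k) =
      Real.sqrt (1 - ‖g‖ ^ 2 + inner ℝ g (‖k‖⁻¹ • k) ^ 2) := by
    unfold nullDir
    generalize Real.sqrt (1 - ‖g‖ ^ 2 + inner ℝ g (‖k‖⁻¹ • k) ^ 2) = c
    generalize ‖k‖⁻¹ • k = n at *
    rw [inner_add_right, inner_sub_right, real_inner_smul_right, real_inner_smul_right, h1,
      real_inner_comm]
    ring
  rw [← h2, real_inner_smul_left] at hs
  exact (mul_pos_iff_of_pos_left (inv_pos.2 hk')).1 hs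

/-- A unit vector with the same tangential part as `g` is one of the two null directions, and in
particular not tangential. -/
theorem inner_ne_zero_of_tangential_eq (hg : ‖g‖ < 1) (hk : k ≠ 0) (hv : ‖v‖ = 1)
    (hvg : ∀ w, inner ℝ k w = 0 → inner ℝ v w = inner ℝ g w) :
    inner ℝ k v ≠ 0 ∧ (0 < inner ℝ k v → v = nullDir g k) := by
  have hk' : 0 < ‖k‖ := norm_pos_iff.2 hk
  set n := ‖k‖⁻¹ • k with hn
  have hn1 : ‖n‖ = 1 := norm_inv_norm_smul_self hk
  have hnn : inner ℝ n n = (1 : ℝ) := by rw [real_inner_self_eq_norm_sq, hn1, one_pow]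
  have hkn : ∀ w, inner ℝ n w = ‖k‖⁻¹ * inner ℝ k w := fun w => by
    rw [hn, real_inner_smul_left]
  have hkn' : ∀ w, inner ℝ k w = ‖k‖ * inner ℝ n w := fun w => by
    rw [hkn, ← mul_assoc, mul_inv_cancel₀ hk'.ne', one_mul]
  set w := (v - g) - inner ℝ (v - g) n • n with hw
  have hnw : inner ℝ n w = 0 := by
    rw [hw, inner_sub_right, real_inner_smul_right, hnn, real_inner_comm]; ring
  have hvw := hvg w (by rw [hkn', hnw, mul_zero])
  have hw0 : w = 0 := by
    rw [← inner_self_eq_zero (𝕜 := ℝ)]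
    have : inner ℝ w w = inner ℝ (v - g) w - inner ℝ (v - g) n * inner ℝ n w := by
      conv_lhs => rw [hw]
      rw [← hw, inner_sub_left, real_inner_smul_left]
    rw [this, hnw, inner_sub_left, hvw]; ring
  have hvn : v = g - inner ℝ g n • n + inner ℝ v n • n := by
    have : v - g = inner ℝ (v - g) n • n := sub_eq_zero.1 hw0
    rw [inner_sub_left, sub_smul] at this
    rw [sub_add_eq_add_sub, add_sub_assoc, ← this]; abel
  have hsq : inner ℝ v n ^ 2 = 1 - ‖g‖ ^ 2 + inner ℝ g n ^ 2 := by
    have h1 := norm_sub_inner_smul_add_smul_sq (g := g) n hn1 (inner ℝ v n)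
    rw [← hvn, hv] at h1
    linarith
  have hpos := one_sub_norm_sq_add_pos hg (inner ℝ g n)
  have hkv : inner ℝ k v = ‖k‖ * inner ℝ v n := by rw [hkn', real_inner_comm]
  refine ⟨fun h0 => ?_, fun hpos' => ?_⟩
  · rw [hkv, mul_eq_zero, or_iff_right hk'.ne'] at h0
    rw [h0] at hsq; linarith
  · rw [hkv] at hpos'
    have : inner ℝ v n = Real.sqrt (1 - ‖g‖ ^ 2 + inner ℝ g n ^ 2) := by
      rw [← hsq, Real.sqrt_sq ((mul_pos_iff_of_pos_left hk').1 hpos').le]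
    rw [nullDir, ← hn, ← this]; exact hvn

end

theorem ContDiffOn.gradient {E : Type*} [NormedAddCommGroup E] [InnerProductSpace ℝ E]
    [CompleteSpace E] {F : E → ℝ} {s : Set E} {m n : WithTop ℕ∞} (hF : ContDiffOn ℝ n F s)
    (hs : IsOpen s) (hmn : m + 1 ≤ n) : ContDiffOn ℝ m (gradient F) s :=
  (InnerProductSpace.toDual ℝ E).symm.contDiff.comp_contDiffOn
    (hF.fderiv_of_isOpen hs hmn)

theorem ContDiffOn.nullDir {E : Type*} [NormedAddCommGroup E] [InnerProductSpace ℝ E]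
    {g k : E → E} {s : Set E} {n : WithTop ℕ∞} (hg : ContDiffOn ℝ n g s)
    (hk : ContDiffOn ℝ n k s) (hg1 : ∀ x ∈ s, ‖g x‖ < 1) (hk0 : ∀ x ∈ s, k x ≠ 0) :
    ContDiffOn ℝ n (fun x => nullDir (g x) (k x)) s := by
  have hν : ContDiffOn ℝ n (fun x => ‖k x‖⁻¹ • k x) s :=
    ((hk.norm ℝ hk0).inv fun x hx => norm_ne_zero_iff.2 (hk0 x hx)).smul hk
  have hi : ContDiffOn ℝ n (fun x => Inner.inner ℝ (g x) (‖k x‖⁻¹ • k x)) s := hg.inner ℝ hν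
  have hsq : ContDiffOn ℝ n
      (fun x => Real.sqrt (1 - ‖g x‖ ^ 2 + Inner.inner ℝ (g x) (‖k x‖⁻¹ • k x) ^ 2)) s :=
    ((contDiffOn_const.sub (hg.norm_sq ℝ)).add (hi.pow 2)).sqrt
      fun x hx => (one_sub_norm_sq_add_pos (hg1 x hx) _).ne'
  exact (hg.sub (hi.smul hν)).add (hsq.smul hν)

theorem gradient_ne_zero_of_fderiv_ne_zero {h : E3 → ℝ} {x : E3} (hx : fderiv ℝ h x ≠ 0) :
    gradient h x ≠ 0 := fun h0 => hx (by
  have : (InnerProductSpace.toDual ℝ E3).symm (fderiv ℝ h x) = 0 := h0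
  simpa using this)

namespace IsSurfaceChart

variable {S : Set E3} {φ φ' : E2 → E3} {V' : Set E2} {y₀ : E2} {r : ℝ} {U : Set E3} {P : E3 → E2}
  {h : E3 → ℝ}

theorem hasFDerivAt_defining (H : IsSurfaceChart S φ y₀ r U P h) {x : E3} (hx : x ∈ U) :
    HasFDerivAt h (fderiv ℝ h x) x :=
  ((H.contDiffOn_defining.contDiffAt (H.flat.isOpen.mem_nhds hx)).differentiableAt
    (by simp)).hasFDerivAt

theorem hasFDerivAt_proj (H : IsSurfaceChart S φ y₀ r U P h) {x : E3} (hx : x ∈ U) :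
    HasFDerivAt P (fderiv ℝ P x) x :=
  ((H.contDiffOn_proj.contDiffAt (H.flat.isOpen.mem_nhds hx)).differentiableAt
    (by simp)).hasFDerivAt

/-- The range of the differential of any parametrization is the kernel of the differential of a
defining function. -/
theorem inner_gradient_eq_zero_iff (H : IsSurfaceChart S φ y₀ r U P h)
    (hφ' : IsLocalParam S φ' V') {y : E2} (hy : y ∈ V') (hyU : φ' y ∈ U) (w : E3) :
    inner ℝ (gradient h (φ' y)) w = 0 ↔ ∃ a, fderiv ℝ φ' y a = w := by
  rw [inner_gradient_left]
  have hle : LinearMap.range (fderiv ℝ φ' y : E2 →ₗ[ℝ] E3) ≤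
      LinearMap.ker (fderiv ℝ h (φ' y) : E3 →ₗ[ℝ] ℝ) := by
    rintro _ ⟨a, rfl⟩
    have h1 := (H.hasFDerivAt_defining hyU).comp y (hφ'.differentiableAt hy).hasFDerivAt
    have h2 : h ∘ φ' =ᶠ[𝓝 y] fun _ => 0 := by
      filter_upwards [hφ'.isOpen.mem_nhds hy,
        (hφ'.differentiableAt hy).continuousAt.preimage_mem_nhds (H.flat.isOpen.mem_nhds hyU)]
        with z hz hzU
      exact (H.flat.mem_iff _ hzU).1 (hφ'.mem hz)
    have h3 := h1.unique ((hasFDerivAt_const (0 : ℝ) y).congr_of_eventuallyEq h2)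
    exact congrArg (fun l : E2 →L[ℝ] ℝ => l a) h3
  have h1 : Module.finrank ℝ (LinearMap.range (fderiv ℝ φ' y : E2 →ₗ[ℝ] E3)) = 2 := by
    rw [LinearMap.finrank_range_of_inj (hφ'.immersion y hy)]; simp
  have h2 : Module.finrank ℝ (LinearMap.ker (fderiv ℝ h (φ' y) : E3 →ₗ[ℝ] ℝ)) = 2 := by
    have h3 := LinearMap.finrank_range_add_finrank_ker (fderiv ℝ h (φ' y) : E3 →ₗ[ℝ] ℝ)
    have h4 : LinearMap.range (fderiv ℝ h (φ' y) : E3 →ₗ[ℝ] ℝ) = ⊤ := by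
      rw [LinearMap.range_eq_top]
      refine LinearMap.surjective fun h0 => H.fderiv_ne_zero _ hyU ?_
      ext v; exact congrArg (fun l : E3 →ₗ[ℝ] ℝ => l v) h0
    rw [h4, finrank_top] at h3
    rw [Module.finrank_self, finrank_euclideanSpace_fin] at h3
    omega
  have heq := Submodule.eq_of_le_of_finrank_eq hle (h1.trans h2.symm)
  have := SetLike.ext_iff.1 heq w
  exact this.symm

end IsSurfaceChart

theorem HasDerivAt.eventually_pos_of_eq_zero {F : ℝ → ℝ} {c : ℝ} (hF : HasDerivAt F c 0)
    (hc : 0 < c) (h0 : F 0 = 0) : ∀ᶠ s in 𝓝[>] (0 : ℝ), 0 < F s := by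
  have h1 := eventually_nhdsWithin_sign_eq_of_deriv_pos (f := F) (x₀ := 0)
    (by rw [hF.deriv]; exact hc) h0
  filter_upwards [nhdsWithin_le_nhds h1, self_mem_nhdsWithin] with s hs hs0
  rw [sub_zero, sign_pos (Set.mem_Ioi.1 hs0)] at hs
  exact sign_eq_one_iff.1 hs

namespace IsOrientedChart

variable {S Ω : Set E3} {φ : E2 → E3} {y₀ : E2} {r : ℝ} {U : Set E3} {P : E3 → E2} {h : E3 → ℝ}
  {f : E3 → ℝ} {p v : E3}

theorem eventually_mem_extRegion (H : IsOrientedChart S φ y₀ r U P h) (hpU : p ∈ U) (hpS : p ∈ S)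
    (hv : 0 < inner ℝ (gradient h p) v) : ∀ᶠ s : ℝ in 𝓝[>] 0, p + s • v ∈ extRegion S := by
  rw [inner_gradient_left] at hv
  have hl : HasDerivAt (fun s : ℝ => p + s • v) v 0 := by
    simpa using ((hasDerivAt_id (0 : ℝ)).smul_const v).const_add p
  have h1 : HasDerivAt (fun s : ℝ => h (p + s • v)) (fderiv ℝ h p v) 0 := by
    have := H.hasFDerivAt_defining hpU
    exact HasFDerivAt.comp_hasDerivAt (0 : ℝ) (by simpa using this) hl
  have h2 := h1.eventually_pos_of_eq_zero hv (by simpa using (H.flat.mem_iff p hpU).1 hpS)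
  have h3 : ∀ᶠ s : ℝ in 𝓝 0, p + s • v ∈ U :=
    hl.continuousAt.preimage_mem_nhds (H.flat.isOpen.mem_nhds (by simpa using hpU))
  filter_upwards [h2, nhdsWithin_le_nhds h3] with s hs hsU
  exact H.mem_ext _ hsU hs

theorem eventually_mem_intRegion (H : IsOrientedChart S φ y₀ r U P h) (hpU : p ∈ U) (hpS : p ∈ S)
    (hv : inner ℝ (gradient h p) v < 0) : ∀ᶠ s : ℝ in 𝓝[>] 0, p + s • v ∈ intRegion S := by
  rw [inner_gradient_left] at hv
  have hl : HasDerivAt (fun s : ℝ => p + s • v) v 0 := by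
    simpa using ((hasDerivAt_id (0 : ℝ)).smul_const v).const_add p
  have h1 : HasDerivAt (fun s : ℝ => -h (p + s • v)) (-fderiv ℝ h p v) 0 := by
    have := H.hasFDerivAt_defining hpU
    exact (HasFDerivAt.comp_hasDerivAt (0 : ℝ) (by simpa using this) hl).neg
  have h2 := h1.eventually_pos_of_eq_zero (neg_pos.2 hv)
    (by simpa using (H.flat.mem_iff p hpU).1 hpS)
  have h3 : ∀ᶠ s : ℝ in 𝓝 0, p + s • v ∈ U :=
    hl.continuousAt.preimage_mem_nhds (H.flat.isOpen.mem_nhds (by simpa using hpU))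
  filter_upwards [h2, nhdsWithin_le_nhds h3] with s hs hsU
  exact H.mem_int _ hsU (by linarith)

theorem exists_apply_eq (H : IsOrientedChart S φ y₀ r U P h) (hpU : p ∈ U) (hpS : p ∈ S) :
    ∃ y ∈ Metric.ball y₀ r, φ y = p :=
  ⟨P p, H.proj_mem p hpU hpS, H.apply_proj p hpU hpS⟩

/-- A vector `(1, v)` with `|v| = 1` is `m`-orthogonal to `f(S)` iff `v` has the same tangential
part as the gradient of `f`. -/
theorem normal_iff (H : IsOrientedChart S φ y₀ r U P h) (hfp : DifferentiableAt ℝ f p)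
    (hpU : p ∈ U) (hpS : p ∈ S) :
    (∀ X ∈ tangentVectors (graphMap f '' S) (graphMap f p), mink (1, v) X = 0) ↔
      ∀ w, inner ℝ (gradient h p) w = 0 → inner ℝ v w = inner ℝ (gradient f p) w := by
  constructor
  · intro hX w hw
    obtain ⟨y, hy, rfl⟩ := H.exists_apply_eq hpU hpS
    obtain ⟨a, rfl⟩ := (H.inner_gradient_eq_zero_iff H.isLocalParam hy hpU w).1 hw
    have hl : HasDerivAt (fun s : ℝ => y + s • a) a 0 := by
      simpa using ((hasDerivAt_id (0 : ℝ)).smul_const a).const_add y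
    have hφ := (H.isLocalParam.differentiableAt hy).hasFDerivAt
    have h1 : HasDerivAt (fun s : ℝ => φ (y + s • a)) (fderiv ℝ φ y a) 0 :=
      HasFDerivAt.comp_hasDerivAt (0 : ℝ) (by simpa using hφ) hl
    have h2 : HasDerivAt (fun s : ℝ => f (φ (y + s • a))) (fderiv ℝ f (φ y) (fderiv ℝ φ y a)) 0 :=
      HasFDerivAt.comp_hasDerivAt (0 : ℝ) (by simpa using hfp.hasFDerivAt) h1
    have h3 := hX (fderiv ℝ f (φ y) (fderiv ℝ φ y a), fderiv ℝ φ y a)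
      ⟨fun s => graphMap f (φ (y + s • a)), by simp, by
        have : ∀ᶠ s : ℝ in 𝓝 0, y + s • a ∈ Metric.ball y₀ r :=
          hl.continuousAt.preimage_mem_nhds (Metric.isOpen_ball.mem_nhds (by simpa using hy))
        filter_upwards [this] with s hs
        exact Set.mem_image_of_mem _ (H.isLocalParam.mem hs), h2.prodMk h1⟩
    simp only [mink] at h3
    rw [inner_gradient_left]; linarith
  · rintro hv X ⟨γ, hγ0, hγS, hγ⟩
    have hγ2 : HasDerivAt (fun t => (γ t).2) X.2 0 :=
      (hasFDerivAt_snd (𝕜 := ℝ) (p := γ 0)).comp_hasDerivAt (0 : ℝ) hγ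
    have hγ1 : HasDerivAt (fun t => (γ t).1) X.1 0 :=
      (hasFDerivAt_fst (𝕜 := ℝ) (p := γ 0)).comp_hasDerivAt (0 : ℝ) hγ
    have h0 : (γ 0).2 = p := by rw [hγ0]; rfl
    have h1 : HasDerivAt (fun t => h (γ t).2) (fderiv ℝ h p X.2) 0 :=
      HasFDerivAt.comp_hasDerivAt (0 : ℝ) (by rw [h0]; exact H.hasFDerivAt_defining hpU) hγ2
    have h2 : HasDerivAt (fun t => f (γ t).2) (fderiv ℝ f p X.2) 0 :=
      HasFDerivAt.comp_hasDerivAt (0 : ℝ) (by rw [h0]; exact hfp.hasFDerivAt) hγ2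
    have hU : ∀ᶠ t in 𝓝 (0 : ℝ), (γ t).2 ∈ U :=
      hγ2.continuousAt.preimage_mem_nhds (H.flat.isOpen.mem_nhds (by rw [h0]; exact hpU))
    have e1 : (fun t => h (γ t).2) =ᶠ[𝓝 0] fun _ => 0 := by
      filter_upwards [hγS, hU] with t ⟨q, hq, hqt⟩ htU
      rw [← hqt] at htU ⊢
      exact (H.flat.mem_iff _ htU).1 hq
    have e2 : (fun t => (γ t).1) =ᶠ[𝓝 0] fun t => f (γ t).2 := by
      filter_upwards [hγS] with t ⟨q, hq, hqt⟩
      rw [← hqt]; rfl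
    have h3 := h1.unique ((hasDerivAt_const (0 : ℝ) (0 : ℝ)).congr_of_eventuallyEq e1)
    have h4 := hγ1.unique (h2.congr_of_eventuallyEq e2)
    have h5 := hv X.2 (by rw [inner_gradient_left]; exact h3)
    rw [inner_gradient_left] at h5
    simp only [mink]; rw [h5, h4]; ring

/-- The outgoing null normal exists, is unique, and is given by `nullDir`. -/
theorem outgoingNullNormal_eq (H : IsOrientedChart S φ y₀ r U P h) (hfp : DifferentiableAt ℝ f p)
    (hf1 : ‖gradient f p‖ < 1) (hpU : p ∈ U) (hpS : p ∈ S) :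
    outgoingNullNormal S f p = (1, nullDir (gradient f p) (gradient h p)) := by
  have hk := gradient_ne_zero_of_fderiv_ne_zero (H.fderiv_ne_zero p hpU)
  have hex : IsOutgoingNullNormal S f p (1, nullDir (gradient f p) (gradient h p)) := by
    refine ⟨rfl, norm_nullDir hf1 hk, (H.normal_iff hfp hpU hpS).2 fun w hw =>
      inner_nullDir_of_inner_eq_zero hw, ?_⟩
    have := H.eventually_mem_extRegion hpU hpS (inner_nullDir_pos hf1 hk)
    obtain ⟨ε, hε, hsub⟩ := mem_nhdsGT_iff_exists_Ioo_subset.1 this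
    exact ⟨ε, hε, hsub⟩
  have hL : IsOutgoingNullNormal S f p (outgoingNullNormal S f p) :=
    Classical.epsilon_spec ⟨_, hex⟩
  generalize outgoingNullNormal S f p = L at hL
  obtain ⟨t, v⟩ := L
  obtain ⟨ht, hv, hn, ε, hε, hout⟩ := hL
  simp only at ht hv hout
  subst ht
  obtain ⟨hne, hpos⟩ := inner_ne_zero_of_tangential_eq hf1 hk hv ((H.normal_iff hfp hpU hpS).1 hn)
  rcases lt_or_gt_of_ne hne with h1 | h1
  · exfalso
    have h2 : ∀ᶠ s : ℝ in 𝓝[>] 0, s ∈ Set.Ioo 0 ε := Ioo_mem_nhdsGT hε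
    obtain ⟨s, hs1, hs2⟩ := ((H.eventually_mem_intRegion hpU hpS h1).and h2).exists
    exact (hout s hs2).2 hs1.2
  · rw [hpos h1]

end IsOrientedChart

/-- A segment starting at a point of `S` in an inward direction `v` meets `S` again, and
the chord up to the first such point lies in the interior. -/
theorem exists_chord_of_eventually_mem_intRegion {S : Set E3} (hS : IsCompact S) {p v : E3}
    (hv : ‖v‖ = 1) (hint : ∀ᶠ s : ℝ in 𝓝[>] 0, p + s • v ∈ intRegion S) :
    ∃ s > (0 : ℝ), p + s • v ∈ S ∧ openSegment ℝ p (p + s • v) ⊆ intRegion S := by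
  obtain ⟨ε, hε, hsub⟩ := mem_nhdsGT_iff_exists_Ioo_subset.1 hint
  have hε : 0 < ε := hε
  have hcont : Continuous fun s : ℝ => p + s • v := by fun_prop
  -- a connected piece of the ray off `S` issuing from the interior stays in one bounded component
  have hcomp : ∀ I : Set ℝ, IsPreconnected I → ε / 2 ∈ I → (∀ s ∈ I, p + s • v ∉ S) →
      (fun s : ℝ => p + s • v) '' I ⊆ connectedComponentIn Sᶜ (p + (ε / 2) • v) := by
    intro I hI hεI hIS
    refine (hI.image _ hcont.continuousOn).subset_connectedComponentIn
      (Set.mem_image_of_mem _ hεI) ?_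
    rintro _ ⟨s, hs, rfl⟩; exact hIS s hs
  have h0 : p + (ε / 2) • v ∈ intRegion S := hsub ⟨by positivity, by linarith⟩
  have hinj : ∀ s t : ℝ, ‖(p + s • v) - (p + t • v)‖ = |s - t| := by
    intro s t
    rw [add_sub_add_left_eq_sub, ← sub_smul, norm_smul, hv, mul_one, Real.norm_eq_abs]
  let T : Set ℝ := {s | ε / 2 ≤ s ∧ p + s • v ∈ S}
  have hTne : T.Nonempty := by
    by_contra hT
    have h1 := hcomp (Set.Ici (ε / 2)) isPreconnected_Ici Set.self_mem_Ici
      (fun s hs hsS => hT ⟨s, hs, hsS⟩)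
    obtain ⟨r, hr⟩ := (h0.2.subset h1).subset_closedBall (p + (ε / 2) • v)
    have h2 := hr (Set.mem_image_of_mem _ (show ε / 2 + (|r| + 1) ∈ Set.Ici (ε / 2) by
      simp; positivity))
    rw [mem_closedBall_iff_norm, hinj, add_sub_cancel_left, abs_of_nonneg (by positivity)] at h2
    linarith [le_abs_self r]
  have hTcl : IsClosed T :=
    isClosed_Ici.inter (hS.isClosed.preimage hcont)
  have hTbd : BddBelow T := ⟨ε / 2, fun s hs => hs.1⟩
  have hmem := hTcl.csInf_mem hTne hTbd
  set s := sInf T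
  have hs0 : 0 < s := (half_pos hε).trans_le hmem.1
  refine ⟨s, hs0, hmem.2, ?_⟩
  have hoff : ∀ t ∈ Set.Ioo 0 s, p + t • v ∉ S := by
    intro t ht htS
    by_cases h1 : ε / 2 ≤ t
    · exact absurd (csInf_le hTbd ⟨h1, htS⟩) (not_le.2 ht.2)
    · exact (hsub ⟨ht.1, by linarith⟩ : p + t • v ∈ intRegion S).1 htS
  have hεs : ε / 2 < s := lt_of_le_of_ne hmem.1 fun h1 => h0.1 (h1 ▸ hmem.2)
  have h1 := hcomp (Set.Ioo 0 s) isPreconnected_Ioo ⟨by positivity, hεs⟩ hoff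
  rintro _ ⟨a, b, ha, hb, hab, rfl⟩
  have e : a • p + b • (p + s • v) = p + (b * s) • v := by
    rw [smul_add, ← add_assoc, ← add_smul, hab, one_smul, smul_smul]
  have hbs : b * s ∈ Set.Ioo 0 s := ⟨by positivity, by nlinarith⟩
  rw [e]
  refine ⟨hoff _ hbs, ?_⟩
  have h2 := connectedComponentIn_eq (h1 (Set.mem_image_of_mem _ hbs))
  rw [← h2]; exact h0.2

/-- A minimizer on `S` of the retarded time `f - ⟨·, w⟩` has `(1, w)` as its outgoing null normal.
This is the point at which the chord condition enters: it excludes that `w` points inward. -/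
theorem IsOrientedChart.eq_nullDir_of_isMinOn {S : Set E3} {φ : E2 → E3} {y₀ : E2} {r : ℝ}
    {U : Set E3} {P : E3 → E2} {h f : E3 → ℝ} {p w : E3} (H : IsOrientedChart S φ y₀ r U P h)
    (hS : IsCompact S) (hfp : DifferentiableAt ℝ f p) (hf1 : ‖gradient f p‖ < 1)
    (hpU : p ∈ U) (hpS : p ∈ S) (hw : ‖w‖ = 1)
    (hchord : ∀ q ∈ S, p ≠ q → openSegment ℝ p q ⊆ intRegion S → |f p - f q| < dist p q)
    (hmin : IsMinOn (fun q => f q - inner ℝ q w) S p) :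
    w = nullDir (gradient f p) (gradient h p) := by
  have hk := gradient_ne_zero_of_fderiv_ne_zero (H.fderiv_ne_zero p hpU)
  have htan : ∀ a, inner ℝ (gradient h p) a = 0 → inner ℝ w a = inner ℝ (gradient f p) a := by
    intro a ha
    obtain ⟨y, hy, rfl⟩ := H.exists_apply_eq hpU hpS
    obtain ⟨b, rfl⟩ := (H.inner_gradient_eq_zero_iff H.isLocalParam hy hpU a).1 ha
    have hφ := (H.isLocalParam.differentiableAt hy).hasFDerivAt
    have h1 : HasFDerivAt (fun z => f (φ z) - inner ℝ w (φ z))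
        ((fderiv ℝ f (φ y)).comp (fderiv ℝ φ y) - (innerSL ℝ w).comp (fderiv ℝ φ y)) y :=
      (hfp.hasFDerivAt.comp y hφ).sub ((innerSL ℝ w).hasFDerivAt.comp y hφ)
    have h2 : IsLocalMin (fun z => f (φ z) - inner ℝ w (φ z)) y := by
      filter_upwards [Metric.isOpen_ball.mem_nhds hy] with z hz
      have := hmin (H.isLocalParam.mem hz)
      simpa [real_inner_comm] using this
    have h3 := congrArg (fun l : E2 →L[ℝ] ℝ => l b) (h2.hasFDerivAt_eq_zero h1)
    simp only [sub_apply, ContinuousLinearMap.comp_apply, innerSL_apply_apply,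
      zero_apply] at h3
    rw [inner_gradient_left]; linarith
  obtain ⟨hne, hpos⟩ := inner_ne_zero_of_tangential_eq hf1 hk hw htan
  rcases lt_or_gt_of_ne hne with h1 | h1
  · exfalso
    obtain ⟨s, hs, hsS, hseg⟩ := exists_chord_of_eventually_mem_intRegion hS hw
      (H.eventually_mem_intRegion hpU hpS h1)
    have hd : dist p (p + s • w) = s := by
      rw [dist_self_add_right, norm_smul, hw, mul_one, Real.norm_eq_abs, abs_of_pos hs]
    have hne' : p ≠ p + s • w := by
      intro heq; rw [← heq, dist_self] at hd; exact hs.ne hd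
    have h2 := hchord _ hsS hne' hseg
    have h3 : f p - inner ℝ p w ≤ f (p + s • w) - inner ℝ (p + s • w) w := hmin hsS
    rw [inner_add_left, real_inner_smul_left, real_inner_self_eq_norm_sq, hw] at h3
    rw [hd] at h2
    linarith [le_abs_self (f p - f (p + s • w)), neg_abs_le (f p - f (p + s • w))]
  · exact hpos h1

/-! ### Linear algebra of the two fundamental forms -/

/-- The determinant of three vectors of `ℝ³`. -/
noncomputable def tripleDet (a b c : E3) : ℝ := Matrix.det (Matrix.of fun i => (![a, b, c] i).ofLp)

theorem tripleDet_mul_tripleDet (a b c a' b' c' : E3) :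
    tripleDet a b c * tripleDet a' b' c' =
      Matrix.det (Matrix.of fun i j => inner ℝ (![a, b, c] i) (![a', b', c'] j)) := by
  rw [tripleDet, tripleDet, ← Matrix.det_transpose (Matrix.of fun i => (![a', b', c'] i).ofLp),
    ← Matrix.det_mul]
  congr 1
  ext i j
  simp only [Matrix.mul_apply, Matrix.of_apply, Matrix.transpose_apply, PiLp.inner_apply]
  exact Finset.sum_congr rfl fun k _ => by simp [mul_comm]

theorem trace_inv_mul_fin_two (g χ : Matrix (Fin 2) (Fin 2) ℝ) :
    (g⁻¹ * χ).trace = (g 1 1 * χ 0 0 - g 0 1 * χ 1 0 - g 1 0 * χ 0 1 + g 0 0 * χ 1 1) / g.det := by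
  rw [Matrix.inv_def, Matrix.adjugate_fin_two, Ring.inverse_eq_inv', Matrix.trace_fin_two]
  simp [Matrix.mul_apply, Fin.sum_univ_two]
  ring

/-- The inequality between the arithmetic and the geometric mean of the eigenvalues of a symmetric
form `χ` with respect to a positive definite form `g`. -/
theorem four_mul_det_le_trace_sq_mul_det {g χ : Matrix (Fin 2) (Fin 2) ℝ} (hg : g 0 1 = g 1 0)
    (hχ : χ 0 1 = χ 1 0) (hdet : 0 < g.det) :
    4 * χ.det ≤ (g⁻¹ * χ).trace ^ 2 * g.det := by
  rw [trace_inv_mul_fin_two, div_pow, div_mul_eq_mul_div, le_div_iff₀ (by positivity)]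
  rw [Matrix.det_fin_two] at hdet
  rw [Matrix.det_fin_two, Matrix.det_fin_two, ← hg, ← hχ]
  rw [← hg] at hdet
  generalize g 0 0 = a at *
  generalize g 0 1 = b at *
  generalize g 1 1 = c at *
  generalize χ 0 0 = x at *
  generalize χ 0 1 = y at *
  generalize χ 1 1 = z at *
  have ha : 0 < a ^ 2 := by
    refine sq_pos_of_ne_zero fun h0 => ?_
    subst h0; nlinarith [sq_nonneg b]
  -- complete the square in `χ - λ g`, after diagonalizing `g` by a shear
  have key : 0 ≤ a ^ 2 * ((c * x - b * y - b * y + a * z) ^ 2 -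
      4 * (x * z - y * y) * (a * c - b * b)) := by
    have e : a ^ 2 * ((c * x - b * y - b * y + a * z) ^ 2 -
        4 * (x * z - y * y) * (a * c - b * b)) =
        ((a * c - b * b) * x - (a ^ 2 * z - 2 * a * b * y + b ^ 2 * x)) ^ 2 +
          4 * (a * c - b * b) * (a * y - b * x) ^ 2 := by ring
    rw [e]; positivity
  have := nonneg_of_mul_nonneg_right key ha
  nlinarith

theorem trace_inv_mul_congr {g χ M : Matrix (Fin 2) (Fin 2) ℝ} (hM : IsUnit M.det) :
    ((M.transpose * g * M)⁻¹ * (M.transpose * χ * M)).trace = (g⁻¹ * χ).trace := by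
  have hMt : IsUnit M.transpose.det := by rwa [Matrix.det_transpose]
  rw [Matrix.mul_inv_rev, Matrix.mul_inv_rev]
  have : M⁻¹ * (g⁻¹ * M.transpose⁻¹) * (M.transpose * χ * M) = M⁻¹ * (g⁻¹ * χ) * M := by
    simp only [Matrix.mul_assoc]
    rw [Matrix.nonsing_inv_mul_cancel_left _ _ hMt]
  rw [this, Matrix.trace_mul_comm, ← Matrix.mul_assoc, Matrix.mul_nonsing_inv _ hM, Matrix.one_mul]

/-- A positive semidefinite symmetric `2 × 2` form has non-negative determinant. -/
theorem det_nonneg_of_forall_nonneg {a b c : ℝ}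
    (h : ∀ s t : ℝ, 0 ≤ a * s ^ 2 + 2 * b * (s * t) + c * t ^ 2) : 0 ≤ a * c - b * b := by
  have ha : 0 ≤ a := by simpa using h 1 0
  rcases ha.eq_or_lt with h0 | h0
  · subst h0
    have hb : b = 0 := by
      by_contra hb
      have := h (-(c + 1) / (2 * b)) 1
      have e : 2 * b * (-(c + 1) / (2 * b) * 1) = -(c + 1) := by field_simp
      rw [e] at this; linarith
    simp [hb]
  · have := h (-b) a
    have e : a * (-b) ^ 2 + 2 * b * (-b * a) + c * a ^ 2 = a * (a * c - b * b) := by ring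
    rw [e] at this
    exact nonneg_of_mul_nonneg_right this h0

/-- The Hessian of a function at a local minimum is positive semidefinite. -/
theorem IsLocalMin.second_fderiv_nonneg {E : Type*} [NormedAddCommGroup E] [NormedSpace ℝ E]
    {G : E → ℝ} {G' : E → E →L[ℝ] ℝ} {G'' : E →L[ℝ] E →L[ℝ] ℝ} {y : E} (hmin : IsLocalMin G y)
    (hG : ∀ᶠ z in 𝓝 y, HasFDerivAt G (G' z) z) (hG' : HasFDerivAt G' G'' y) (a : E) :
    0 ≤ G'' a a := by
  have hl : ∀ t : ℝ, HasDerivAt (fun s : ℝ => y + s • a) a t := fun t => by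
    simpa using ((hasDerivAt_id t).smul_const a).const_add y
  have hl0 : Filter.Tendsto (fun s : ℝ => y + s • a) (𝓝 0) (𝓝 y) := by
    have := (hl 0).continuousAt.tendsto; simpa using this
  have h1 : ∀ᶠ t in 𝓝 (0 : ℝ), HasDerivAt (fun s : ℝ => G (y + s • a)) (G' (y + t • a) a) t := by
    filter_upwards [hl0.eventually hG] with t ht
    exact ht.comp_hasDerivAt t (hl t)
  have h2 : deriv (fun s : ℝ => G (y + s • a)) =ᶠ[𝓝 0] fun t => G' (y + t • a) a :=
    h1.mono fun t ht => ht.deriv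
  have h3 : HasDerivAt (fun t : ℝ => G' (y + t • a) a) (G'' a a) 0 := by
    have h4 : HasDerivAt (fun t : ℝ => G' (y + t • a)) (G'' a) 0 :=
      HasFDerivAt.comp_hasDerivAt (0 : ℝ) (by simpa using hG') (hl 0)
    simpa using h4.clm_apply (hasDerivAt_const (0 : ℝ) a)
  have h5 : deriv (deriv fun s : ℝ => G (y + s • a)) 0 = G'' a a := by
    rw [h2.deriv_eq, h3.deriv]
  have hmin1 : IsLocalMin (fun s : ℝ => G (y + s • a)) 0 := by
    have : ∀ᶠ s : ℝ in 𝓝 0, G y ≤ G (y + s • a) := hl0.eventually hmin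
    simpa [IsLocalMin, IsMinFilter] using this
  by_contra! hneg
  have hmax := isLocalMax_of_deriv_deriv_neg (h5.trans_lt hneg) hmin1.deriv_eq_zero
    h1.self_of_nhds.continuousAt
  have hconst : (fun s : ℝ => G (y + s • a)) =ᶠ[𝓝 0] fun _ => G (y + (0 : ℝ) • a) := by
    filter_upwards [hmin1, hmax] with s hs1 hs2
    exact le_antisymm hs2 hs1
  have h6 := hconst.deriv.deriv_eq
  rw [h5] at h6
  simp at h6
  exact hneg.ne h6

/-! ### The null expansion in an arbitrary parametrization -/

/-- The coordinate vector fields of a parametrization. -/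
noncomputable def coordDeriv (φ : E2 → E3) (y : E2) (A : Fin 2) : E3 :=
  fderiv ℝ φ y (EuclideanSpace.single A 1)

section
variable {S : Set E3} {f : E3 → ℝ} {φ : E2 → E3} {V : Set E2} {y : E2}

theorem coordVec_eq (hf : DifferentiableAt ℝ f (φ y)) (hφ : DifferentiableAt ℝ φ y) (A : Fin 2) :
    coordVec f φ y A = (fderiv ℝ f (φ y) (coordDeriv φ y A), coordDeriv φ y A) := by
  have h1 : HasFDerivAt (fun z => graphMap f (φ z))
      (((fderiv ℝ f (φ y)).comp (fderiv ℝ φ y)).prod (fderiv ℝ φ y)) y :=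
    (hf.hasFDerivAt.comp y hφ.hasFDerivAt).prodMk hφ.hasFDerivAt
  rw [coordVec, h1.fderiv]; rfl

theorem inducedMetric_apply (hf : DifferentiableAt ℝ f (φ y)) (hφ : DifferentiableAt ℝ φ y)
    (A B : Fin 2) : inducedMetric f φ y A B =
      inner ℝ (coordDeriv φ y A) (coordDeriv φ y B) -
        fderiv ℝ f (φ y) (coordDeriv φ y A) * fderiv ℝ f (φ y) (coordDeriv φ y B) := by
  simp only [inducedMetric, Matrix.of_apply, coordVec_eq hf hφ, mink]
  ring

theorem inducedMetric_comm (A B : Fin 2) : inducedMetric f φ y A B = inducedMetric f φ y B A := by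
  simp only [inducedMetric, Matrix.of_apply, mink]
  rw [real_inner_comm, mul_comm]

theorem IsLocalParam.linearCombination_ne_zero (hφ : IsLocalParam S φ V) (hy : y ∈ V) {s t : ℝ}
    (hst : s ≠ 0 ∨ t ≠ 0) : s • coordDeriv φ y 0 + t • coordDeriv φ y 1 ≠ 0 := by
  intro h0
  have h1 : fderiv ℝ φ y (s • EuclideanSpace.single 0 1 + t • EuclideanSpace.single 1 1) = 0 := by
    rw [map_add, map_smul, map_smul]; exact h0
  have h2 := hφ.immersion y hy (h1.trans (map_zero _).symm)
  have h3 := congrArg (fun v : E2 => v 0) h2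
  have h4 := congrArg (fun v : E2 => v 1) h2
  simp at h3 h4
  rcases hst with h | h
  · exact h h3
  · exact h h4

theorem inducedMetric_det_pos (hφ : IsLocalParam S φ V) (hy : y ∈ V)
    (hf : DifferentiableAt ℝ f (φ y)) (hf1 : ‖gradient f (φ y)‖ < 1) :
    0 < (inducedMetric f φ y).det := by
  have hq : ∀ s t : ℝ, s ≠ 0 ∨ t ≠ 0 → 0 < s ^ 2 * inducedMetric f φ y 0 0 +
      2 * (s * t) * inducedMetric f φ y 0 1 + t ^ 2 * inducedMetric f φ y 1 1 := by
    intro s t hst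
    simp only [inducedMetric_apply hf (hφ.differentiableAt hy)]
    have hw := norm_pos_iff.2 (hφ.linearCombination_ne_zero hy hst)
    set w := s • coordDeriv φ y 0 + t • coordDeriv φ y 1 with hwdef
    have h1 : fderiv ℝ f (φ y) w ^ 2 < ‖w‖ ^ 2 := by
      rw [← inner_gradient_left]
      rw [sq_lt_sq, abs_norm]
      refine (abs_real_inner_le_norm _ _).trans_lt ?_
      exact mul_lt_of_lt_one_left hw hf1
    rw [← real_inner_self_eq_norm_sq] at h1
    rw [hwdef] at h1
    simp only [inner_add_left, inner_add_right, real_inner_smul_left, real_inner_smul_right,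
      map_add, map_smul, smul_eq_mul, real_inner_comm (coordDeriv φ y 0) (coordDeriv φ y 1)] at h1
    nlinarith
  rw [Matrix.det_fin_two, inducedMetric_comm 1 0]
  have h0 : 0 < inducedMetric f φ y 0 0 := by simpa using hq 1 0 (by simp)
  have h1 := hq (-inducedMetric f φ y 0 1) (inducedMetric f φ y 0 0) (Or.inr h0.ne')
  refine (mul_pos_iff_of_pos_left h0).1 ?_
  linarith

theorem IsLocalParam.continuousOn_coordDeriv (hφ : IsLocalParam S φ V) (A : Fin 2) :
    ContinuousOn (fun y => coordDeriv φ y A) V :=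
  (hφ.smooth.continuousOn_fderiv_of_isOpen hφ.isOpen (by simp)).clm_apply continuousOn_const

theorem continuousOn_inducedMetric {Ω : Set E3} (hφ : IsLocalParam S φ V) (hΩ : IsOpen Ω)
    (hSΩ : S ⊆ Ω) (hf : ContDiffOn ℝ ∞ f Ω) (A B : Fin 2) :
    ContinuousOn (fun y => inducedMetric f φ y A B) V := by
  have hdf : ContinuousOn (fun y => fderiv ℝ f (φ y)) V :=
    (hf.continuousOn_fderiv_of_isOpen hΩ (by simp)).comp hφ.smooth.continuousOn
      fun y hy => hSΩ (hφ.mem hy)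
  have hA := hφ.continuousOn_coordDeriv A
  have hB := hφ.continuousOn_coordDeriv B
  refine ((hA.inner hB).sub ((hdf.clm_apply hA).mul (hdf.clm_apply hB))).congr fun y hy => ?_
  exact inducedMetric_apply ((hf.contDiffAt (hΩ.mem_nhds (hSΩ (hφ.mem hy)))).differentiableAt
    (by simp)) (hφ.differentiableAt hy) A B

end

/-- The spatial part of the outgoing null normal, extended off the surface by means of a defining
function. -/
noncomputable def nullField (f h : E3 → ℝ) (x : E3) : E3 := nullDir (gradient f x) (gradient h x)

namespace IsOrientedChart

variable {S Ω : Set E3} {φ φ' : E2 → E3} {V' : Set E2} {y₀ y : E2} {r : ℝ} {U : Set E3}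
  {P : E3 → E2} {h f : E3 → ℝ}

theorem contDiffOn_nullField (H : IsOrientedChart S φ y₀ r U P h) (hf : ContDiffOn ℝ ∞ f U)
    (hf1 : ∀ x ∈ U, ‖gradient f x‖ < 1) : ContDiffOn ℝ 1 (nullField f h) U :=
  ContDiffOn.nullDir (hf.gradient H.flat.isOpen (WithTop.coe_le_coe.2 le_top))
    (H.contDiffOn_defining.gradient H.flat.isOpen (by norm_num)) hf1
    fun x hx => gradient_ne_zero_of_fderiv_ne_zero (H.fderiv_ne_zero x hx)

theorem hasFDerivAt_nullField (H : IsOrientedChart S φ y₀ r U P h) (hf : ContDiffOn ℝ ∞ f U)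
    (hf1 : ∀ x ∈ U, ‖gradient f x‖ < 1) {x : E3} (hx : x ∈ U) :
    HasFDerivAt (nullField f h) (fderiv ℝ (nullField f h) x) x :=
  (((H.contDiffOn_nullField hf hf1).contDiffAt (H.flat.isOpen.mem_nhds hx)).differentiableAt
    (by simp)).hasFDerivAt

theorem differentiableAt (H : IsOrientedChart S φ y₀ r U P h) (hf : ContDiffOn ℝ ∞ f U) {x : E3}
    (hx : x ∈ U) : DifferentiableAt ℝ f x :=
  (hf.contDiffAt (H.flat.isOpen.mem_nhds hx)).differentiableAt (by simp)

theorem nullSecondForm_apply (H : IsOrientedChart S φ y₀ r U P h) (hf : ContDiffOn ℝ ∞ f U)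
    (hf1 : ∀ x ∈ U, ‖gradient f x‖ < 1) (hφ' : IsLocalParam S φ' V') (hy : y ∈ V')
    (hyU : φ' y ∈ U) (A B : Fin 2) : nullSecondForm S f φ' y A B =
      inner ℝ (fderiv ℝ (nullField f h) (φ' y) (coordDeriv φ' y A)) (coordDeriv φ' y B) := by
  have h1 : HasFDerivAt (fun z => ((1 : ℝ), nullField f h (φ' z)))
      ((0 : E2 →L[ℝ] ℝ).prod ((fderiv ℝ (nullField f h) (φ' y)).comp (fderiv ℝ φ' y))) y :=
    (hasFDerivAt_const (1 : ℝ) y).prodMk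
      ((H.hasFDerivAt_nullField hf hf1 hyU).comp y (hφ'.differentiableAt hy).hasFDerivAt)
  have h2 : (fun z => outgoingNullNormal S f (φ' z)) =ᶠ[𝓝 y]
      fun z => ((1 : ℝ), nullField f h (φ' z)) := by
    filter_upwards [hφ'.isOpen.mem_nhds hy,
      (hφ'.differentiableAt hy).continuousAt.preimage_mem_nhds (H.flat.isOpen.mem_nhds hyU)]
      with z hz hzU
    exact H.outgoingNullNormal_eq (H.differentiableAt hf hzU) (hf1 _ hzU) hzU (hφ'.mem hz)
  simp only [nullSecondForm, Matrix.of_apply]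
  rw [h2.fderiv_eq, h1.fderiv, coordVec_eq (H.differentiableAt hf hyU) (hφ'.differentiableAt hy)]
  simp [mink, coordDeriv]

end IsOrientedChart

namespace IsSurfaceChart

variable {S : Set E3} {φ φ' : E2 → E3} {V' : Set E2} {y₀ y : E2} {r : ℝ} {U : Set E3} {P : E3 → E2}
  {h : E3 → ℝ}

theorem hasFDerivAt_transition (H : IsSurfaceChart S φ y₀ r U P h) (hφ' : IsLocalParam S φ' V')
    (hy : y ∈ V') (hyU : φ' y ∈ U) :
    HasFDerivAt (fun z => P (φ' z)) ((fderiv ℝ P (φ' y)).comp (fderiv ℝ φ' y)) y :=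
  (H.hasFDerivAt_proj hyU).comp y (hφ'.differentiableAt hy).hasFDerivAt

theorem fderiv_eq_comp_transition (H : IsSurfaceChart S φ y₀ r U P h)
    (hφ' : IsLocalParam S φ' V') (hy : y ∈ V') (hyU : φ' y ∈ U) :
    fderiv ℝ φ' y = (fderiv ℝ φ (P (φ' y))).comp ((fderiv ℝ P (φ' y)).comp (fderiv ℝ φ' y)) := by
  have hP := H.proj_mem _ hyU (hφ'.mem hy)
  have h1 := (H.isLocalParam.differentiableAt hP).hasFDerivAt.comp y
    (H.hasFDerivAt_transition hφ' hy hyU)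
  have h2 : φ' =ᶠ[𝓝 y] φ ∘ fun z => P (φ' z) := by
    filter_upwards [hφ'.isOpen.mem_nhds hy,
      (hφ'.differentiableAt hy).continuousAt.preimage_mem_nhds (H.flat.isOpen.mem_nhds hyU)]
      with z hz hzU
    exact (H.apply_proj _ hzU (hφ'.mem hz)).symm
  exact (h1.congr_of_eventuallyEq h2).fderiv

/-- The transition map from a parametrization `φ'` to that of the chart has an invertible Jacobian
matrix, which relates the coordinate vector fields. -/
theorem exists_transition_matrix (H : IsSurfaceChart S φ y₀ r U P h)
    (hφ' : IsLocalParam S φ' V') (hy : y ∈ V') (hyU : φ' y ∈ U) :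
    ∃ M : Matrix (Fin 2) (Fin 2) ℝ, IsUnit M.det ∧
      M.det = ((fderiv ℝ P (φ' y)).comp (fderiv ℝ φ' y)).det ∧
      ∀ A, coordDeriv φ' y A = ∑ B, M B A • coordDeriv φ (P (φ' y)) B := by
  set T := (fderiv ℝ P (φ' y)).comp (fderiv ℝ φ' y) with hT
  have hcomp := H.fderiv_eq_comp_transition hφ' hy hyU
  rw [← hT] at hcomp
  let b := (EuclideanSpace.basisFun (Fin 2) ℝ).toBasis
  have hdet : (LinearMap.toMatrix b b (T : E2 →ₗ[ℝ] E2)).det = T.det := LinearMap.det_toMatrix _ _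
  refine ⟨LinearMap.toMatrix b b (T : E2 →ₗ[ℝ] E2), ?_, hdet, fun A => ?_⟩
  · rw [hdet, isUnit_iff_ne_zero]
    have hinj : Function.Injective T := by
      intro u v huv
      refine hφ'.immersion y hy ?_
      rw [hcomp]; simp only [ContinuousLinearMap.comp_apply]; rw [huv]
    intro h0
    have := LinearMap.bot_lt_ker_of_det_eq_zero (f := (T : E2 →ₗ[ℝ] E2)) h0
    rw [LinearMap.ker_eq_bot.2 hinj] at this
    exact lt_irrefl _ this
  · have h1 : T (EuclideanSpace.single A 1) =
        ∑ B, LinearMap.toMatrix b b (T : E2 →ₗ[ℝ] E2) B A • EuclideanSpace.single B (1 : ℝ) := by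
      ext i
      fin_cases i <;> simp [LinearMap.toMatrix_apply, b]
    rw [coordDeriv, hcomp, ContinuousLinearMap.comp_apply, h1, map_sum]
    simp only [map_smul]; rfl

end IsSurfaceChart

namespace IsOrientedChart

variable {S Ω : Set E3} {φ φ' : E2 → E3} {V' : Set E2} {y₀ y : E2} {r : ℝ} {U : Set E3}
  {P : E3 → E2} {h f : E3 → ℝ}

/-- Both fundamental forms transform under the transition map as bilinear forms do. -/
theorem exists_transition_forms (H : IsOrientedChart S φ y₀ r U P h) (hf : ContDiffOn ℝ ∞ f U)
    (hf1 : ∀ x ∈ U, ‖gradient f x‖ < 1) (hφ' : IsLocalParam S φ' V') (hy : y ∈ V')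
    (hyU : φ' y ∈ U) :
    ∃ M : Matrix (Fin 2) (Fin 2) ℝ, IsUnit M.det ∧
      M.det = ((fderiv ℝ P (φ' y)).comp (fderiv ℝ φ' y)).det ∧
      inducedMetric f φ' y = M.transpose * inducedMetric f φ (P (φ' y)) * M ∧
      nullSecondForm S f φ' y = M.transpose * nullSecondForm S f φ (P (φ' y)) * M := by
  obtain ⟨M, hM, hMdet, hMφ⟩ := H.exists_transition_matrix hφ' hy hyU
  have hP := H.proj_mem _ hyU (hφ'.mem hy)
  have hx := H.apply_proj _ hyU (hφ'.mem hy)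
  have hfd := H.differentiableAt hf hyU
  refine ⟨M, hM, hMdet, ?_, ?_⟩
  · ext A B
    rw [inducedMetric_apply hfd (hφ'.differentiableAt hy)]
    simp only [Matrix.mul_apply, Fin.sum_univ_two, Matrix.transpose_apply]
    simp only [inducedMetric_apply (hx.symm ▸ hfd) (H.isLocalParam.differentiableAt hP), hx, hMφ,
      Fin.sum_univ_two, inner_add_left, inner_add_right, real_inner_smul_left,
      real_inner_smul_right, map_add, map_smul, smul_eq_mul]
    ring
  · ext A B
    rw [H.nullSecondForm_apply hf hf1 hφ' hy hyU]
    simp only [Matrix.mul_apply, Fin.sum_univ_two, Matrix.transpose_apply]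
    simp only [H.nullSecondForm_apply hf hf1 H.isLocalParam hP (hx.symm ▸ hyU), hx, hMφ,
      Fin.sum_univ_two, inner_add_left, inner_add_right, real_inner_smul_left,
      real_inner_smul_right, map_add, map_smul]
    ring

theorem trace_eq_trace_chart (H : IsOrientedChart S φ y₀ r U P h) (hf : ContDiffOn ℝ ∞ f U)
    (hf1 : ∀ x ∈ U, ‖gradient f x‖ < 1) (hφ' : IsLocalParam S φ' V') (hy : y ∈ V')
    (hyU : φ' y ∈ U) :
    ((inducedMetric f φ' y)⁻¹ * nullSecondForm S f φ' y).trace =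
      ((inducedMetric f φ (P (φ' y)))⁻¹ * nullSecondForm S f φ (P (φ' y))).trace := by
  obtain ⟨M, hM, -, h1, h2⟩ := H.exists_transition_forms hf hf1 hφ' hy hyU
  rw [h1, h2, trace_inv_mul_congr hM]

/-- The null expansion may be computed in the parametrization of the chart. -/
theorem nullExpansion_eq (H : IsOrientedChart S φ y₀ r U P h) (hf : ContDiffOn ℝ ∞ f U)
    (hf1 : ∀ x ∈ U, ‖gradient f x‖ < 1) {x : E3} (hxU : x ∈ U) (hxS : x ∈ S) :
    nullExpansion S f x =
      ((inducedMetric f φ (P x))⁻¹ * nullSecondForm S f φ (P x)).trace := by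
  have hex : ∃ c : (E2 → E3) × Set E2 × E2,
      IsLocalParam S c.1 c.2.1 ∧ c.2.2 ∈ c.2.1 ∧ c.1 c.2.2 = x :=
    ⟨(φ, Metric.ball y₀ r, P x), H.isLocalParam, H.proj_mem x hxU hxS, H.apply_proj x hxU hxS⟩
  rw [nullExpansion, dif_pos hex]
  obtain ⟨h1, h2, h3⟩ := hex.choose_spec
  have := H.trace_eq_trace_chart hf hf1 h1 h2 (by rw [h3]; exact hxU)
  rw [this, h3]

theorem continuousOn_nullSecondForm (H : IsOrientedChart S φ y₀ r U P h) (hf : ContDiffOn ℝ ∞ f U)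
    (hf1 : ∀ x ∈ U, ‖gradient f x‖ < 1) (A B : Fin 2) :
    ContinuousOn (fun y => nullSecondForm S f φ y A B) (Metric.ball y₀ r) := by
  have hV : ContinuousOn (fun y => fderiv ℝ (nullField f h) (φ y)) (Metric.ball y₀ r) :=
    ((H.contDiffOn_nullField hf hf1).continuousOn_fderiv_of_isOpen H.flat.isOpen (by simp)).comp
      H.isLocalParam.smooth.continuousOn H.map_mem
  exact ((hV.clm_apply (H.isLocalParam.continuousOn_coordDeriv A)).inner
    (H.isLocalParam.continuousOn_coordDeriv B)).congr fun y hy =>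
      H.nullSecondForm_apply hf hf1 H.isLocalParam hy (H.map_mem y hy) A B

end IsOrientedChart

/-- The null expansion is continuous on the surface. -/
theorem continuousOn_nullExpansion {S Ω : Set E3} {f : E3 → ℝ} (hS : IsClosedEmbeddedSurface S)
    (hΩ : IsOpen Ω) (hSΩ : S ⊆ Ω) (hf : ContDiffOn ℝ ∞ f Ω) (hf1 : ∀ x ∈ Ω, ‖gradient f x‖ < 1) :
    ContinuousOn (nullExpansion S f) S := by
  intro p hp
  obtain ⟨φ, y₀, r, U, P, h, H, hpU, hUΩ⟩ :=
    hS.exists_isOrientedChart hp (hΩ.mem_nhds (hSΩ hp))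
  have hfU := hf.mono hUΩ
  have hf1U : ∀ x ∈ U, ‖gradient f x‖ < 1 := fun x hx => hf1 x (hUΩ hx)
  have hg := fun A B => continuousOn_inducedMetric H.isLocalParam hΩ hSΩ hf A B
  have hχ := fun A B => H.continuousOn_nullSecondForm hfU hf1U A B
  have htr : ContinuousOn (fun y => ((inducedMetric f φ y)⁻¹ * nullSecondForm S f φ y).trace)
      (Metric.ball y₀ r) := by
    simp only [trace_inv_mul_fin_two]
    refine ContinuousOn.div (((((hg 1 1).mul (hχ 0 0)).sub ((hg 0 1).mul (hχ 1 0))).sub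
      ((hg 1 0).mul (hχ 0 1))).add ((hg 0 0).mul (hχ 1 1))) ?_ ?_
    · simp only [Matrix.det_fin_two]
      exact ((hg 0 0).mul (hg 1 1)).sub ((hg 0 1).mul (hg 1 0))
    · intro y hy
      exact (inducedMetric_det_pos H.isLocalParam hy
        (H.differentiableAt hfU (H.map_mem y hy)) (hf1U _ (H.map_mem y hy))).ne'
  have h1 : ContinuousOn (nullExpansion S f) (U ∩ S) :=
    (htr.comp (H.contDiffOn_proj.continuousOn.mono Set.inter_subset_left)
      fun x hx => H.proj_mem x hx.1 hx.2).congr fun x hx => H.nullExpansion_eq hfU hf1U hx.1 hx.2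
  have h2 := h1 p ⟨hpU, hp⟩
  rwa [Set.inter_comm, continuousWithinAt_inter (H.flat.isOpen.mem_nhds hpU)] at h2

/-! ### The null second fundamental form at the minimizers of a retarded time -/

namespace IsOrientedChart

variable {S : Set E3} {φ : E2 → E3} {y₀ y : E2} {r : ℝ} {U : Set E3}
  {P : E3 → E2} {h f : E3 → ℝ} {w : E3}

/-- Where the outgoing null normal is `(1, w)`, the null second fundamental form is the Hessian of
the retarded time `f - ⟨·, w⟩` along the surface. At a minimizer it is therefore symmetric and
positive semidefinite. -/
theorem nullSecondForm_symm_and_det_nonneg (H : IsOrientedChart S φ y₀ r U P h)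
    (hf : ContDiffOn ℝ ∞ f U) (hf1 : ∀ x ∈ U, ‖gradient f x‖ < 1) (hy : y ∈ Metric.ball y₀ r)
    (hmin : IsMinOn (fun q => f q - inner ℝ q w) S (φ y)) (hw : w = nullField f h (φ y)) :
    nullSecondForm S f φ y 0 1 = nullSecondForm S f φ y 1 0 ∧
      0 ≤ (nullSecondForm S f φ y).det := by
  let I : E3 →L[ℝ] E3 →L[ℝ] ℝ := innerSL ℝ
  have hI : ∀ a b, I a b = inner ℝ a b := fun _ _ => rfl
  let G : E2 → ℝ := fun z => f (φ z) - inner ℝ w (φ z)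
  let G' : E2 → E2 →L[ℝ] ℝ := fun z =>
    (I (nullField f h (φ z) - w)).comp (fderiv ℝ φ z)
  have hG : ∀ᶠ z in 𝓝 y, HasFDerivAt G (G' z) z := by
    filter_upwards [Metric.isOpen_ball.mem_nhds hy] with z hz
    have hzU := H.map_mem z hz
    have hφ := (H.isLocalParam.differentiableAt hz).hasFDerivAt
    have h1 : HasFDerivAt G
        ((fderiv ℝ f (φ z)).comp (fderiv ℝ φ z) - (I w).comp (fderiv ℝ φ z)) z :=
      ((H.differentiableAt hf hzU).hasFDerivAt.comp z hφ).sub ((I w).hasFDerivAt.comp z hφ)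
    convert h1 using 1
    ext a
    have h2 : inner ℝ (nullField f h (φ z)) (fderiv ℝ φ z a) =
        inner ℝ (gradient f (φ z)) (fderiv ℝ φ z a) :=
      inner_nullDir_of_inner_eq_zero
        ((H.inner_gradient_eq_zero_iff H.isLocalParam hz hzU _).2 ⟨a, rfl⟩)
    rw [inner_gradient_left] at h2
    simp only [G', ContinuousLinearMap.comp_apply, hI, sub_apply, inner_sub_left,
      h2]
  have hmin' : IsLocalMin G y := by
    filter_upwards [Metric.isOpen_ball.mem_nhds hy] with z hz
    have := hmin (H.isLocalParam.mem hz)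
    simpa [G, real_inner_comm] using this
  have hu : HasFDerivAt (fun z => I (nullField f h (φ z) - w))
      (I.comp ((fderiv ℝ (nullField f h) (φ y)).comp (fderiv ℝ φ y))) y :=
    I.hasFDerivAt.comp y
      (((H.hasFDerivAt_nullField hf hf1 (H.map_mem y hy)).comp y
        (H.isLocalParam.differentiableAt hy).hasFDerivAt).sub_const w)
  have hDφ : HasFDerivAt (fderiv ℝ φ) (fderiv ℝ (fderiv ℝ φ) y) y :=
    (((H.isLocalParam.contDiffAt hy).fderiv_right (m := 1)
      (WithTop.coe_le_coe.2 le_top)).differentiableAt (by simp)).hasFDerivAt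
  have hG' := hu.clm_comp hDφ
  have happ : ∀ a b : E2, inner ℝ (fderiv ℝ (nullField f h) (φ y) (fderiv ℝ φ y a))
      (fderiv ℝ φ y b) = ((ContinuousLinearMap.compL ℝ E2 E3 ℝ
        (I (nullField f h (φ y) - w))).comp (fderiv ℝ (fderiv ℝ φ) y) +
      ((ContinuousLinearMap.compL ℝ E2 E3 ℝ).flip (fderiv ℝ φ y)).comp
        (I.comp ((fderiv ℝ (nullField f h) (φ y)).comp (fderiv ℝ φ y)))) a b := by
    intro a b
    rw [← hw, sub_self]
    simp [hI]
  have hsymm : ∀ a b : E2, inner ℝ (fderiv ℝ (nullField f h) (φ y) (fderiv ℝ φ y a))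
      (fderiv ℝ φ y b) = inner ℝ (fderiv ℝ (nullField f h) (φ y) (fderiv ℝ φ y b))
      (fderiv ℝ φ y a) := by
    intro a b
    rw [happ, happ]
    exact second_derivative_symmetric_of_eventually hG hG' a b
  have hpsd : ∀ a : E2, 0 ≤ inner ℝ (fderiv ℝ (nullField f h) (φ y) (fderiv ℝ φ y a))
      (fderiv ℝ φ y a) := by
    intro a
    rw [happ]
    exact hmin'.second_fderiv_nonneg hG hG' a
  have hχ := H.nullSecondForm_apply hf hf1 H.isLocalParam hy (H.map_mem y hy)
  have h01 : nullSecondForm S f φ y 0 1 = nullSecondForm S f φ y 1 0 := by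
    rw [hχ, hχ]; exact hsymm _ _
  refine ⟨h01, ?_⟩
  rw [Matrix.det_fin_two, ← h01]
  refine det_nonneg_of_forall_nonneg fun s t => ?_
  have h1 := hpsd (s • EuclideanSpace.single 0 1 + t • EuclideanSpace.single 1 1)
  have h2 : fderiv ℝ φ y (s • EuclideanSpace.single 0 1 + t • EuclideanSpace.single 1 1) =
      s • coordDeriv φ y 0 + t • coordDeriv φ y 1 := by
    rw [map_add, map_smul, map_smul]; rfl
  rw [h2] at h1
  simp only [map_add, map_smul, inner_add_left, inner_add_right, real_inner_smul_left,
    real_inner_smul_right, ← hχ] at h1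
  rw [← h01] at h1
  linarith

/-- The pointwise estimate behind the theorem: at a minimizer, the squared null expansion times the
area density dominates four times the Jacobian of the Gauss map `v` of null directions. The
Gram determinants of `(v, ∂₁v, ∂₂v)` and `(v, ∂₁φ, ∂₂φ)` identify this Jacobian with
`det χ / √(det g)`. -/
theorem four_mul_abs_tripleDet_le (H : IsOrientedChart S φ y₀ r U P h)
    (hf : ContDiffOn ℝ ∞ f U) (hf1 : ∀ x ∈ U, ‖gradient f x‖ < 1) (hy : y ∈ Metric.ball y₀ r)
    (hmin : IsMinOn (fun q => f q - inner ℝ q w) S (φ y)) (hw : w = nullField f h (φ y)) :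
    4 * |tripleDet (nullField f h (φ y))
        (fderiv ℝ (nullField f h) (φ y) (coordDeriv φ y 0))
        (fderiv ℝ (nullField f h) (φ y) (coordDeriv φ y 1))| ≤
      nullExpansion S f (φ y) ^ 2 * Real.sqrt (inducedMetric f φ y).det := by
  have hyU := H.map_mem y hy
  obtain ⟨hsymm, hdet⟩ := H.nullSecondForm_symm_and_det_nonneg hf hf1 hy hmin hw
  have hχ := H.nullSecondForm_apply hf hf1 H.isLocalParam hy hyU
  have hg := fun A B => inducedMetric_apply (H.differentiableAt hf hyU)
    (H.isLocalParam.differentiableAt hy) A B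
  have hgpos := inducedMetric_det_pos H.isLocalParam hy (H.differentiableAt hf hyU) (hf1 _ hyU)
  have htr := four_mul_det_le_trace_sq_mul_det (inducedMetric_comm 0 1) hsymm hgpos
  rw [H.nullExpansion_eq hf hf1 hyU (H.isLocalParam.mem hy), H.proj_apply y hy]
  set v := nullField f h (φ y) with hv
  have hvn : ∀ᶠ z in 𝓝 y, inner ℝ (nullField f h (φ z)) (nullField f h (φ z)) = (1 : ℝ) := by
    filter_upwards [Metric.isOpen_ball.mem_nhds hy] with z hz
    have hzU := H.map_mem z hz
    rw [real_inner_self_eq_norm_sq, nullField, norm_nullDir (hf1 _ hzU)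
      (gradient_ne_zero_of_fderiv_ne_zero (H.fderiv_ne_zero _ hzU)), one_pow]
  have hvv : inner ℝ v v = (1 : ℝ) := hvn.self_of_nhds
  have hDv : ∀ A, inner ℝ (fderiv ℝ (nullField f h) (φ y) (coordDeriv φ y A)) v = 0 := by
    intro A
    have h1 := (H.hasFDerivAt_nullField hf hf1 hyU).comp y
      (H.isLocalParam.differentiableAt hy).hasFDerivAt
    have h2 := h1.inner ℝ h1
    have h3 := h2.unique ((hasFDerivAt_const (1 : ℝ) y).congr_of_eventuallyEq hvn)
    have h4 := congrArg (fun l : E2 →L[ℝ] ℝ => l (EuclideanSpace.single A 1)) h3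
    simp only [ContinuousLinearMap.comp_apply, ContinuousLinearMap.prod_apply,
      fderivInnerCLM_apply, Function.comp_apply, zero_apply] at h4
    rw [real_inner_comm, add_self_eq_zero] at h4
    rw [← h4, hv]; rfl
  have hvφ : ∀ A, inner ℝ v (coordDeriv φ y A) = fderiv ℝ f (φ y) (coordDeriv φ y A) := by
    intro A
    rw [← inner_gradient_left]
    exact inner_nullDir_of_inner_eq_zero
      ((H.inner_gradient_eq_zero_iff H.isLocalParam hy hyU _).2 ⟨_, rfl⟩)
  have hφv : ∀ A, inner ℝ (coordDeriv φ y A) v = fderiv ℝ f (φ y) (coordDeriv φ y A) :=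
    fun A => by rw [real_inner_comm, hvφ]
  set J := tripleDet v (fderiv ℝ (nullField f h) (φ y) (coordDeriv φ y 0))
    (fderiv ℝ (nullField f h) (φ y) (coordDeriv φ y 1)) with hJ
  set K := tripleDet v (coordDeriv φ y 0) (coordDeriv φ y 1) with hK
  have hJK : J * K = (nullSecondForm S f φ y).det := by
    rw [hJ, hK, tripleDet_mul_tripleDet, Matrix.det_fin_three, Matrix.det_fin_two]
    simp only [Matrix.of_apply, Matrix.cons_val_zero, Matrix.cons_val_one, Matrix.cons_val, hvv,
      hDv, hχ]
    ring
  have hKK : K ^ 2 = (inducedMetric f φ y).det := by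
    rw [sq, hK, tripleDet_mul_tripleDet, Matrix.det_fin_three, Matrix.det_fin_two]
    simp only [Matrix.of_apply, Matrix.cons_val_zero, Matrix.cons_val_one, Matrix.cons_val, hvv,
      hg, hvφ, hφv, real_inner_comm (coordDeriv φ y 0) (coordDeriv φ y 1)]
    ring
  rw [← hKK, Real.sqrt_sq_eq_abs]
  have hKpos : 0 < |K| := by
    rw [abs_pos]; intro h0; rw [h0] at hKK; simp at hKK; linarith
  rw [← hJK] at htr hdet
  rw [← hKK, ← sq_abs K] at htr
  have h5 : J * K = |J| * |K| := by rw [← abs_mul, abs_of_nonneg hdet]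
  rw [h5] at htr
  refine le_of_mul_le_mul_right ?_ hKpos
  linarith

end IsOrientedChart

/-! ### The contact set of the null convex hull -/

/-- The points of `S⁺` are the minimizers of the retarded times `f - ⟨·, w⟩` on `S`. -/
theorem mem_SPlus_iff {S : Set E3} {f : E3 → ℝ} {p : E3} :
    p ∈ SPlus S f ↔ p ∈ S ∧ ∃ w : E3, ‖w‖ = 1 ∧ IsMinOn (fun q => f q - inner ℝ q w) S p := by
  refine and_congr_right fun hp => ?_
  constructor
  · rintro ⟨-, hnot⟩
    by_contra! hall
    refine hnot (mem_interior_iff_mem_nhds.2 ?_)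
    have h1 : ∀ᶠ z : Spacetime in 𝓝 (graphMap f p), ∀ w ∈ Metric.sphere (0 : E3) 1,
        ∃ q ∈ S, f q - inner ℝ q w < z.1 - inner ℝ z.2 w := by
      refine (isCompact_sphere (0 : E3) 1).eventually_forall_of_forall_eventually fun w hw => ?_
      have h2 := hall w (by simpa using hw)
      simp only [IsMinOn, IsMinFilter, Filter.eventually_principal, not_forall, not_le] at h2
      obtain ⟨q, hq, hlt⟩ := h2
      have hc1 : Continuous fun z : Spacetime × E3 => f q - inner ℝ q z.2 := by fun_prop
      have hc2 : Continuous fun z : Spacetime × E3 => z.1.1 - inner ℝ z.1.2 z.2 := by fun_prop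
      filter_upwards [hc1.continuousAt.eventually_lt hc2.continuousAt (x₀ := (graphMap f p, w)) hlt]
        with z hz
      exact ⟨q, hq, hz⟩
    filter_upwards [h1] with z hz w u hw hsub
    obtain ⟨q, hq, hlt⟩ := hz w (by simpa using hw)
    have h3 : u ≤ f q - inner ℝ q w := hsub (Set.mem_image_of_mem _ hq)
    exact h3.trans hlt.le
  · rintro ⟨w, hw, hmin⟩
    refine ⟨subset_closure fun w' u _ hsub => hsub (Set.mem_image_of_mem _ hp), fun hint => ?_⟩
    have hc : Filter.Tendsto (fun ε : ℝ => ((f p - ε, p) : Spacetime)) (𝓝[>] 0)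
        (𝓝 (graphMap f p)) := by
      have : Continuous fun ε : ℝ => ((f p - ε, p) : Spacetime) := by fun_prop
      have := this.tendsto 0
      rw [sub_zero] at this
      exact this.mono_left nhdsWithin_le_nhds
    obtain ⟨ε, hε, hε0⟩ :=
      ((hc.eventually (mem_interior_iff_mem_nhds.1 hint)).and self_mem_nhdsWithin).exists
    have h1 : f p - inner ℝ p w ≤ f p - ε - inner ℝ p w :=
      hε w _ hw (by rintro _ ⟨q, hq, rfl⟩; exact hmin hq)
    have : 0 < ε := hε0
    linarith

theorem isCompact_SPlus {S : Set E3} {f : E3 → ℝ} (hS : IsCompact S) (hf : ContinuousOn f S) :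
    IsCompact (SPlus S f) := by
  have h1 : ContinuousOn (graphMap f) S := hf.prodMk continuousOn_id
  exact hS.of_isClosed_subset (h1.preimage_isClosed_of_isClosed hS.isClosed isClosed_frontier)
    fun _ h => h.1

/-! ### Finiteness of the area measure -/

/-- The area density of a parametrization. -/
noncomputable def areaDensity (f : E3 → ℝ) (φ : E2 → E3) (y : E2) : ENNReal :=
  ENNReal.ofReal (Real.sqrt (inducedMetric f φ y).det)

/-- The area measure carried by the image of a single parametrization. -/
noncomputable def paramMeasure (f : E3 → ℝ) (φ : E2 → E3) (V : Set E2) : Measure E3 :=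
  Measure.map φ ((volume.restrict V).withDensity (areaDensity f φ))

theorem paramMeasure_le_areaMeasure {S : Set E3} {f : E3 → ℝ} {φ : E2 → E3} {V : Set E2}
    (hφ : IsLocalParam S φ V) : paramMeasure f φ V ≤ areaMeasure S f :=
  le_iSup_of_le φ (le_iSup_of_le V (le_iSup_of_le hφ le_rfl))

theorem ContinuousOn.measurableSet_inter_preimage {α β : Type*} [TopologicalSpace α]
    [MeasurableSpace α] [OpensMeasurableSpace α] [TopologicalSpace β] [MeasurableSpace β]
    [BorelSpace β] [Nonempty β] {g : α → β} {s : Set α} {t : Set β} (hg : ContinuousOn g s)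
    (hs : MeasurableSet s) (ht : MeasurableSet t) : MeasurableSet (s ∩ g ⁻¹' t) := by
  classical
  have h1 : Measurable (s.piecewise g fun _ => Classical.arbitrary β) :=
    hg.measurable_piecewise continuousOn_const hs
  have h2 : s ∩ g ⁻¹' t = s ∩ (s.piecewise g fun _ => Classical.arbitrary β) ⁻¹' t := by
    ext x
    refine and_congr_right fun hx => ?_
    rw [Set.mem_preimage, Set.mem_preimage, Set.piecewise_eq_of_mem _ _ _ hx]
  rw [h2]
  exact hs.inter (h1 ht)

namespace IsLocalParam

variable {S Ω : Set E3} {f : E3 → ℝ} {φ : E2 → E3} {V : Set E2}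

theorem aemeasurable (hφ : IsLocalParam S φ V) (ρ : E2 → ENNReal) :
    AEMeasurable φ ((volume.restrict V).withDensity ρ) :=
  (hφ.smooth.continuousOn.aemeasurable hφ.isOpen.measurableSet).mono_ac
    (withDensity_absolutelyContinuous _ _)

theorem paramMeasure_apply (hφ : IsLocalParam S φ V) {A : Set E3} (hA : MeasurableSet A) :
    paramMeasure f φ V A = ∫⁻ y in V ∩ φ ⁻¹' A, areaDensity f φ y := by
  rw [paramMeasure, Measure.map_apply_of_aemeasurable (hφ.aemeasurable _) hA, withDensity_apply',
    Measure.restrict_restrict' hφ.isOpen.measurableSet, Set.inter_comm]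

theorem continuousOn_sqrt_det (hφ : IsLocalParam S φ V) (hΩ : IsOpen Ω) (hSΩ : S ⊆ Ω)
    (hf : ContDiffOn ℝ ∞ f Ω) :
    ContinuousOn (fun y => Real.sqrt (inducedMetric f φ y).det) V := by
  have hg := fun A B => continuousOn_inducedMetric hφ hΩ hSΩ hf A B
  simp only [Matrix.det_fin_two]
  exact (((hg 0 0).mul (hg 1 1)).sub ((hg 0 1).mul (hg 1 0))).sqrt

end IsLocalParam

namespace IsOrientedChart

variable {S Ω : Set E3} {φ φ' : E2 → E3} {V' : Set E2} {y₀ y : E2} {r : ℝ} {U : Set E3}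
  {P : E3 → E2} {h f : E3 → ℝ}

theorem areaDensity_eq (H : IsOrientedChart S φ y₀ r U P h) (hf : ContDiffOn ℝ ∞ f U)
    (hf1 : ∀ x ∈ U, ‖gradient f x‖ < 1) (hφ' : IsLocalParam S φ' V') (hy : y ∈ V')
    (hyU : φ' y ∈ U) :
    areaDensity f φ' y = ENNReal.ofReal |((fderiv ℝ P (φ' y)).comp (fderiv ℝ φ' y)).det| *
      areaDensity f φ (P (φ' y)) := by
  obtain ⟨M, -, hMdet, h1, -⟩ := H.exists_transition_forms hf hf1 hφ' hy hyU
  rw [areaDensity, areaDensity, ← hMdet, ← ENNReal.ofReal_mul (abs_nonneg _), h1, Matrix.det_mul,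
    Matrix.det_mul, Matrix.det_transpose]
  congr 1
  rw [show ∀ a b : ℝ, a * b * a = a ^ 2 * b from fun a b => by ring,
    Real.sqrt_mul (sq_nonneg _), Real.sqrt_sq_eq_abs]

/-- Within the domain of a chart, no parametrization measures more area than that of the chart. -/
theorem paramMeasure_le (H : IsOrientedChart S φ y₀ r U P h) (hf : ContDiffOn ℝ ∞ f U)
    (hf1 : ∀ x ∈ U, ‖gradient f x‖ < 1) (hφ' : IsLocalParam S φ' V') {A : Set E3}
    (hA : MeasurableSet A) (hAU : A ⊆ U) :
    paramMeasure f φ' V' A ≤ paramMeasure f φ (Metric.ball y₀ r) A := by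
  rw [hφ'.paramMeasure_apply hA, H.isLocalParam.paramMeasure_apply hA]
  have hs : MeasurableSet (V' ∩ φ' ⁻¹' A) :=
    hφ'.smooth.continuousOn.measurableSet_inter_preimage hφ'.isOpen.measurableSet hA
  have hinj : Set.InjOn (fun z => P (φ' z)) (V' ∩ φ' ⁻¹' A) := by
    intro a ha b hb hab
    refine hφ'.injOn ha.1 hb.1 ?_
    have e1 := H.apply_proj _ (hAU ha.2) (hφ'.mem ha.1)
    have e2 := H.apply_proj _ (hAU hb.2) (hφ'.mem hb.1)
    simp only at hab
    rw [← e1, hab, e2]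
  have hcv := lintegral_image_eq_lintegral_abs_det_fderiv_mul volume hs
    (fun y hy => (H.hasFDerivAt_transition hφ' hy.1 (hAU hy.2)).hasFDerivWithinAt) hinj
    (areaDensity f φ)
  have h1 : ∫⁻ y in V' ∩ φ' ⁻¹' A, areaDensity f φ' y = ∫⁻ y in V' ∩ φ' ⁻¹' A,
      ENNReal.ofReal |((fderiv ℝ P (φ' y)).comp (fderiv ℝ φ' y)).det| *
        areaDensity f φ (P (φ' y)) :=
    setLIntegral_congr_fun hs fun y hy => H.areaDensity_eq hf hf1 hφ' hy.1 (hAU hy.2)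
  rw [h1, ← hcv]
  refine lintegral_mono_set ?_
  rintro _ ⟨y, hy, rfl⟩
  refine ⟨H.proj_mem _ (hAU hy.2) (hφ'.mem hy.1), ?_⟩
  simp only [Set.mem_preimage]
  rw [H.apply_proj _ (hAU hy.2) (hφ'.mem hy.1)]
  exact hy.2

theorem paramMeasure_univ_lt_top (H : IsOrientedChart S φ y₀ r U P h) (hΩ : IsOpen Ω)
    (hSΩ : S ⊆ Ω) (hf : ContDiffOn ℝ ∞ f Ω) :
    paramMeasure f φ (Metric.ball y₀ r) Set.univ < ⊤ := by
  obtain ⟨V, hV, hsub⟩ := H.exists_extension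
  obtain ⟨C, hC⟩ := (isCompact_closedBall y₀ r).exists_bound_of_continuousOn
    ((hV.continuousOn_sqrt_det hΩ hSΩ hf).mono hsub)
  rw [H.isLocalParam.paramMeasure_apply MeasurableSet.univ, Set.preimage_univ, Set.inter_univ]
  calc ∫⁻ y in Metric.ball y₀ r, areaDensity f φ y
      ≤ ∫⁻ _ in Metric.ball y₀ r, ENNReal.ofReal C :=
        setLIntegral_mono measurable_const fun y hy => ENNReal.ofReal_le_ofReal
          ((le_abs_self _).trans (hC y (Metric.ball_subset_closedBall hy)))
    _ < ⊤ := by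
        rw [setLIntegral_const]
        exact ENNReal.mul_lt_top ENNReal.ofReal_lt_top measure_ball_lt_top

end IsOrientedChart

/-- The area of a closed surface is finite: finitely many charts bound all parametrizations at
once. -/
theorem isFiniteMeasure_areaMeasure {S Ω : Set E3} {f : E3 → ℝ} (hS : IsClosedEmbeddedSurface S)
    (hΩ : IsOpen Ω) (hSΩ : S ⊆ Ω) (hf : ContDiffOn ℝ ∞ f Ω) (hf1 : ∀ x ∈ Ω, ‖gradient f x‖ < 1) :
    IsFiniteMeasure (areaMeasure S f) := by
  have hch := fun p : S => hS.exists_isOrientedChart p.2 (hΩ.mem_nhds (hSΩ p.2))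
  choose φ y₀ r U P h H hpU hUΩ using hch
  obtain ⟨t, ht⟩ := hS.isCompact.elim_finite_subcover U (fun p => (H p).flat.isOpen)
    fun p hp => Set.mem_iUnion.2 ⟨⟨p, hp⟩, hpU _⟩
  have hle : areaMeasure S f ≤ ∑ p ∈ t, paramMeasure f (φ p) (Metric.ball (y₀ p) (r p)) := by
    refine iSup_le fun φ' => iSup_le fun V' => iSup_le fun hφ' => ?_
    change paramMeasure f φ' V' ≤ _
    rw [Measure.le_iff]
    intro A hA
    rw [Measure.coe_finsetSum, Finset.sum_apply]
    calc paramMeasure f φ' V' A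
        ≤ paramMeasure f φ' V' (⋃ p ∈ t, A ∩ U p) := by
          have hU : MeasurableSet (⋃ p ∈ t, A ∩ U p) :=
            t.measurableSet_biUnion fun p _ => hA.inter (H p).flat.isOpen.measurableSet
          rw [hφ'.paramMeasure_apply hA, hφ'.paramMeasure_apply hU]
          refine lintegral_mono_set fun y hy => ⟨hy.1, ?_⟩
          obtain ⟨p, hp⟩ := Set.mem_iUnion.1 (ht (hφ'.mem hy.1))
          obtain ⟨hpt, hp⟩ := Set.mem_iUnion.1 hp
          exact Set.mem_biUnion hpt ⟨hy.2, hp⟩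
      _ ≤ ∑ p ∈ t, paramMeasure f φ' V' (A ∩ U p) := measure_biUnion_finset_le _ _
      _ ≤ ∑ p ∈ t, paramMeasure f (φ p) (Metric.ball (y₀ p) (r p)) A :=
          Finset.sum_le_sum fun p _ =>
            ((H p).paramMeasure_le (hf.mono (hUΩ p)) (fun x hx => hf1 x (hUΩ p hx)) hφ'
              (hA.inter (H p).flat.isOpen.measurableSet) Set.inter_subset_right).trans
              (measure_mono Set.inter_subset_left)
  refine ⟨(hle Set.univ).trans_lt ?_⟩
  rw [Measure.coe_finsetSum, Finset.sum_apply]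
  exact ENNReal.sum_lt_top.2 fun p _ => (H p).paramMeasure_univ_lt_top hΩ hSΩ hf

/-! ### Volume of cones -/

/-- The coordinates of `ℝ³` split as `ℝ × ℝ²`. -/
noncomputable def splitE3 : E3 ≃ᵐ ℝ × E2 :=
  (MeasurableEquiv.toLp 2 (Fin 3 → ℝ)).symm.trans
    ((MeasurableEquiv.piFinSuccAbove (fun _ : Fin 3 => ℝ) 0).trans
      ((MeasurableEquiv.refl ℝ).prodCongr (MeasurableEquiv.toLp 2 (Fin 2 → ℝ))))

theorem measurePreserving_splitE3 : MeasurePreserving splitE3 volume volume :=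
  ((MeasurePreserving.id volume).prod (PiLp.volume_preserving_toLp (Fin 2))).comp
    ((volume_preserving_piFinSuccAbove (fun _ : Fin 3 => ℝ) 0).comp
      (PiLp.volume_preserving_ofLp (Fin 3)))

theorem ContinuousLinearMap.det_eq_tripleDet (L : E3 →L[ℝ] E3) :
    L.det = tripleDet (L (EuclideanSpace.single 0 1)) (L (EuclideanSpace.single 1 1))
      (L (EuclideanSpace.single 2 1)) := by
  let b := (EuclideanSpace.basisFun (Fin 3) ℝ).toBasis
  have hdet : (LinearMap.toMatrix b b (L : E3 →ₗ[ℝ] E3)).det = L.det := LinearMap.det_toMatrix _ _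
  rw [← hdet, tripleDet, ← Matrix.det_transpose]
  congr 1
  ext i j
  fin_cases i <;> simp [LinearMap.toMatrix_apply, b]

theorem tripleDet_smul (a b c : E3) (t : ℝ) :
    tripleDet a (t • b) (t • c) = t ^ 2 * tripleDet a b c := by
  simp [tripleDet, Matrix.det_fin_three]; ring

theorem lintegral_sq_Ioo : ∫⁻ t in Set.Ioo (0 : ℝ) 1, ENNReal.ofReal (t ^ 2) =
    ENNReal.ofReal (1 / 3) := by
  rw [← ofReal_integral_eq_lintegral_ofReal]
  · rw [← integral_Ioc_eq_integral_Ioo, ← intervalIntegral.integral_of_le zero_le_one, integral_pow]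
    norm_num
  · exact ((continuous_pow 2).integrableOn_Icc (a := 0) (b := 1)).mono_set Set.Ioo_subset_Icc_self
  · exact ae_of_all _ fun t => sq_nonneg t

/-- The volume of the cone with apex `0` over the image of `g` is at most a third of the integral
of the determinant of `(g, ∂₁g, ∂₂g)`. -/
theorem volume_cone_le {g : E2 → E3} {g' : E2 → E2 →L[ℝ] E3} {N : Set E2} (hN : MeasurableSet N)
    (hg : ∀ y ∈ N, HasFDerivAt g (g' y) y)
    (hJ : AEMeasurable (fun y => ENNReal.ofReal |tripleDet (g y) (g' y (EuclideanSpace.single 0 1))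
      (g' y (EuclideanSpace.single 1 1))|) (volume.restrict N)) :
    volume {x | ∃ t ∈ Set.Ioo (0 : ℝ) 1, ∃ y ∈ N, x = t • g y} ≤
      ENNReal.ofReal (1 / 3) * ∫⁻ y in N, ENNReal.ofReal |tripleDet (g y)
        (g' y (EuclideanSpace.single 0 1)) (g' y (EuclideanSpace.single 1 1))| := by
  let proj : E3 →L[ℝ] E2 := LinearMap.toContinuousLinearMap
    { toFun := fun z => WithLp.toLp 2 fun i : Fin 2 => z i.succ
      map_add' := fun _ _ => rfl
      map_smul' := fun _ _ => rfl }
  have hproj : ∀ z, (splitE3 z).2 = proj z := fun z => rfl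
  have happ : ∀ z i, proj z i = z i.succ := fun z i => rfl
  let c0 : E3 →L[ℝ] ℝ := EuclideanSpace.proj 0
  have hc0 : ∀ z, (splitE3 z).1 = c0 z := fun z => rfl
  have hc1 : ∀ z, c0 z = z 0 := fun z => rfl
  let C : Set E3 := splitE3 ⁻¹' (Set.Ioo (0 : ℝ) 1 ×ˢ N)
  have hC : MeasurableSet C := splitE3.measurable (measurableSet_Ioo.prod hN)
  let Θ : E3 → E3 := fun z => c0 z • g (proj z)
  let Θ' : E3 → E3 →L[ℝ] E3 := fun z =>
    c0 z • (g' (proj z)).comp proj + c0.smulRight (g (proj z))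
  have hΘ : ∀ z ∈ C, HasFDerivAt Θ (Θ' z) z := fun z hz =>
    c0.hasFDerivAt.smul ((hg _ hz.2).comp z proj.hasFDerivAt)
  have himage : {x | ∃ t ∈ Set.Ioo (0 : ℝ) 1, ∃ y ∈ N, x = t • g y} ⊆ Θ '' C := by
    rintro _ ⟨t, ht, y, hy, rfl⟩
    refine ⟨splitE3.symm (t, y), by simpa [C] using ⟨ht, hy⟩, ?_⟩
    have h1 : splitE3 (splitE3.symm (t, y)) = (t, y) := splitE3.apply_symm_apply _
    have h2 : c0 (splitE3.symm (t, y)) = t := congrArg Prod.fst h1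
    have h3 : proj (splitE3.symm (t, y)) = y := congrArg Prod.snd h1
    simp only [Θ, h2, h3]
  have hp0 : proj (EuclideanSpace.single 0 1) = 0 := by
    ext i; simp [happ]
  have hp1 : proj (EuclideanSpace.single 1 1) = EuclideanSpace.single 0 1 := by
    ext i; fin_cases i <;> simp [happ]
  have hp2 : proj (EuclideanSpace.single 2 1) = EuclideanSpace.single 1 1 := by
    ext i; fin_cases i <;> simp [happ]
  have hdet : ∀ z, (Θ' z).det = (splitE3 z).1 ^ 2 * tripleDet (g (splitE3 z).2)
      (g' (splitE3 z).2 (EuclideanSpace.single 0 1))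
      (g' (splitE3 z).2 (EuclideanSpace.single 1 1)) := by
    intro z
    rw [ContinuousLinearMap.det_eq_tripleDet, ← tripleDet_smul]
    simp [Θ', hp0, hp1, hp2, hc0, hc1, hproj]
  let G : ℝ × E2 → ENNReal := fun q => ENNReal.ofReal (q.1 ^ 2) *
    ENNReal.ofReal |tripleDet (g q.2) (g' q.2 (EuclideanSpace.single 0 1))
      (g' q.2 (EuclideanSpace.single 1 1))|
  calc volume {x | ∃ t ∈ Set.Ioo (0 : ℝ) 1, ∃ y ∈ N, x = t • g y}
      ≤ volume (Θ '' C) := measure_mono himage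
    _ ≤ ∫⁻ z in C, ENNReal.ofReal |(Θ' z).det| :=
        addHaar_image_le_lintegral_abs_det_fderiv volume hC
          fun z hz => (hΘ z hz).hasFDerivWithinAt
    _ = ∫⁻ z in splitE3 ⁻¹' (Set.Ioo (0 : ℝ) 1 ×ˢ N), G (splitE3 z) := by
        refine lintegral_congr fun z => ?_
        rw [hdet, abs_mul, abs_of_nonneg (sq_nonneg _), ENNReal.ofReal_mul (sq_nonneg _)]
    _ = ∫⁻ q in Set.Ioo (0 : ℝ) 1 ×ˢ N, G q :=
        measurePreserving_splitE3.setLIntegral_comp_preimage_emb splitE3.measurableEmbedding _ _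
    _ = _ := by
        rw [Measure.volume_eq_prod, ← Measure.prod_restrict, ← lintegral_sq_Ioo]
        exact lintegral_prod_mul (f := fun t : ℝ => ENNReal.ofReal (t ^ 2)) (by fun_prop) hJ

/-! ### The total null expansion of the contact set -/

/-- In each chart, the area of the unit sphere covered by the null directions of a set of
minimizers, measured through the cone over it, is controlled by the integral of the squared null
expansion. -/
theorem IsOrientedChart.volume_cone_le_lintegral {S Ω : Set E3} {φ : E2 → E3} {y₀ : E2} {r : ℝ}
    {U : Set E3} {P : E3 → E2} {h f : E3 → ℝ} (H : IsOrientedChart S φ y₀ r U P h)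
    (hS : IsClosedEmbeddedSurface S) (hΩ : IsOpen Ω) (hSΩ : S ⊆ Ω) (hUΩ : U ⊆ Ω)
    (hf : ContDiffOn ℝ ∞ f Ω) (hf1 : ∀ x ∈ Ω, ‖gradient f x‖ < 1)
    (hchord : ∀ p ∈ S, ∀ q ∈ S, p ≠ q → openSegment ℝ p q ⊆ intRegion S → |f p - f q| < dist p q)
    {B : Set E3} (hB : MeasurableSet B) (hBU : B ⊆ U) (hBS : B ⊆ SPlus S f) :
    volume {x | ∃ t ∈ Set.Ioo (0 : ℝ) 1, ∃ p ∈ B, ∃ w : E3, ‖w‖ = 1 ∧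
        IsMinOn (fun q => f q - inner ℝ q w) S p ∧ x = t • w} ≤
      ENNReal.ofReal (1 / 12) * ∫⁻ p in B, ENNReal.ofReal (nullExpansion S f p ^ 2)
        ∂(areaMeasure S f) := by
  have hfU := hf.mono hUΩ
  have hf1U : ∀ x ∈ U, ‖gradient f x‖ < 1 := fun x hx => hf1 x (hUΩ hx)
  have hBS' : B ⊆ S := fun p hp => (hBS hp).1
  have hφ := H.isLocalParam
  set N := Metric.ball y₀ r ∩ φ ⁻¹' B with hN
  have hNm : MeasurableSet N :=
    hφ.smooth.continuousOn.measurableSet_inter_preimage Metric.isOpen_ball.measurableSet hB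
  let g : E2 → E3 := fun y => nullField f h (φ y)
  let g' : E2 → E2 →L[ℝ] E3 := fun y => (fderiv ℝ (nullField f h) (φ y)).comp (fderiv ℝ φ y)
  let J : E2 → ℝ := fun y => |tripleDet (g y) (g' y (EuclideanSpace.single 0 1))
    (g' y (EuclideanSpace.single 1 1))|
  have hg : ∀ y ∈ Metric.ball y₀ r, HasFDerivAt g (g' y) y := fun y hy =>
    (H.hasFDerivAt_nullField hfU hf1U (H.map_mem y hy)).comp y (hφ.differentiableAt hy).hasFDerivAt
  have hnull : ∀ p ∈ B, ∀ w : E3, ‖w‖ = 1 → IsMinOn (fun q => f q - inner ℝ q w) S p →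
      w = nullField f h p := fun p hp w hw hmin =>
    H.eq_nullDir_of_isMinOn hS.isCompact (H.differentiableAt hfU (hBU hp)) (hf1U p (hBU hp))
      (hBU hp) (hBS' hp) hw (hchord p (hBS' hp)) hmin
  have hJc : ContinuousOn J (Metric.ball y₀ r) := by
    have hgc : ContinuousOn g (Metric.ball y₀ r) := fun y hy =>
      (hg y hy).continuousAt.continuousWithinAt
    have hg'c : ContinuousOn g' (Metric.ball y₀ r) :=
      ((((H.contDiffOn_nullField hfU hf1U).continuousOn_fderiv_of_isOpen H.flat.isOpen
        (by simp)).comp hφ.smooth.continuousOn H.map_mem).clm_comp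
        (hφ.smooth.continuousOn_fderiv_of_isOpen hφ.isOpen (by simp)))
    have ha := hg'c.clm_apply (continuousOn_const (c := EuclideanSpace.single (0 : Fin 2) (1 : ℝ)))
    have hb := hg'c.clm_apply (continuousOn_const (c := EuclideanSpace.single (1 : Fin 2) (1 : ℝ)))
    have htd : Continuous fun v : E3 × E3 × E3 => tripleDet v.1 v.2.1 v.2.2 := by
      simp only [tripleDet, Matrix.det_fin_three, Matrix.of_apply, Matrix.cons_val_zero,
        Matrix.cons_val_one, Matrix.cons_val]
      fun_prop
    exact (htd.comp_continuousOn (hgc.prodMk (ha.prodMk hb))).abs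
  have hJm : AEMeasurable (fun y => ENNReal.ofReal (J y)) (volume.restrict N) :=
    ((hJc.mono Set.inter_subset_left).aemeasurable hNm).ennreal_ofReal
  have hHc := continuousOn_nullExpansion hS hΩ hSΩ hf hf1
  -- the integrand, made measurable by cutting it off outside `B`
  let F : E3 → ENNReal := B.indicator fun p => ENNReal.ofReal (nullExpansion S f p ^ 2)
  have hFm : Measurable F := by
    classical
    have h1 : ContinuousOn (fun p => ENNReal.ofReal (nullExpansion S f p ^ 2)) B :=
      ENNReal.continuous_ofReal.comp_continuousOn ((hHc.mono hBS').pow 2)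
    have h2 : Measurable (B.piecewise (fun p => ENNReal.ofReal (nullExpansion S f p ^ 2))
        (0 : E3 → ENNReal)) := h1.measurable_piecewise continuousOn_const hB
    rwa [Set.piecewise_eq_indicator] at h2
  have hρm : AEMeasurable (areaDensity f φ) (volume.restrict (Metric.ball y₀ r)) :=
    ((hφ.continuousOn_sqrt_det hΩ hSΩ hf).aemeasurable
      Metric.isOpen_ball.measurableSet).ennreal_ofReal
  have hFφ : AEMeasurable (fun y => F (φ y)) (volume.restrict (Metric.ball y₀ r)) :=
    hFm.comp_aemeasurable
      (hφ.smooth.continuousOn.aemeasurable Metric.isOpen_ball.measurableSet)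
  have hpt : ∀ y ∈ N, ENNReal.ofReal 4 * ENNReal.ofReal (J y) ≤ areaDensity f φ y * F (φ y) := by
    rintro y ⟨hy, hyB⟩
    obtain ⟨-, w, hw, hmin⟩ := mem_SPlus_iff.1 (hBS hyB)
    have h1 := H.four_mul_abs_tripleDet_le hfU hf1U hy hmin (hnull _ hyB w hw hmin)
    have h2 : F (φ y) = ENNReal.ofReal (nullExpansion S f (φ y) ^ 2) :=
      Set.indicator_of_mem (show φ y ∈ B from hyB) _
    rw [h2, areaDensity, ← ENNReal.ofReal_mul (by norm_num), ← ENNReal.ofReal_mul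
      (Real.sqrt_nonneg _), mul_comm (Real.sqrt _)]
    exact ENNReal.ofReal_le_ofReal h1
  calc volume {x | ∃ t ∈ Set.Ioo (0 : ℝ) 1, ∃ p ∈ B, ∃ w : E3, ‖w‖ = 1 ∧
        IsMinOn (fun q => f q - inner ℝ q w) S p ∧ x = t • w}
      ≤ volume {x | ∃ t ∈ Set.Ioo (0 : ℝ) 1, ∃ y ∈ N, x = t • g y} := by
        refine measure_mono ?_
        rintro _ ⟨t, ht, p, hp, w, hw, hmin, rfl⟩
        have hφP := H.apply_proj p (hBU hp) (hBS' hp)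
        refine ⟨t, ht, P p, ⟨H.proj_mem p (hBU hp) (hBS' hp), ?_⟩, ?_⟩
        · rw [Set.mem_preimage, hφP]; exact hp
        · simp only [g]; rw [hφP, ← hnull p hp w hw hmin]
    _ ≤ ENNReal.ofReal (1 / 3) * ∫⁻ y in N, ENNReal.ofReal (J y) :=
        volume_cone_le hNm (fun y hy => hg y hy.1) hJm
    _ = ENNReal.ofReal (1 / 12) * ∫⁻ y in N, ENNReal.ofReal 4 * ENNReal.ofReal (J y) := by
        rw [lintegral_const_mul'' _ hJm, ← mul_assoc, ← ENNReal.ofReal_mul (by norm_num)]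
        norm_num
    _ ≤ ENNReal.ofReal (1 / 12) * ∫⁻ y in N, areaDensity f φ y * F (φ y) := by
        gcongr 1
        exact setLIntegral_mono' hNm hpt
    _ ≤ ENNReal.ofReal (1 / 12) * ∫⁻ y in Metric.ball y₀ r, areaDensity f φ y * F (φ y) := by
        gcongr 1
        exact lintegral_mono_set Set.inter_subset_left
    _ = ENNReal.ofReal (1 / 12) * ∫⁻ p, F p ∂(paramMeasure f φ (Metric.ball y₀ r)) := by
        rw [paramMeasure, lintegral_map' hFm.aemeasurable (hφ.aemeasurable _),
          lintegral_withDensity_eq_lintegral_mul₀ hρm hFφ]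
        rfl
    _ ≤ ENNReal.ofReal (1 / 12) * ∫⁻ p, F p ∂(areaMeasure S f) := by
        gcongr 1
        exact lintegral_mono' (paramMeasure_le_areaMeasure hφ) le_rfl
    _ = _ := by rw [lintegral_indicator hB]

/-- The total squared null expansion of the contact set is at least `16 π`: the null directions of
the minimizers exhaust the unit sphere, so the cones over them exhaust the unit ball. -/
theorem ofReal_sixteen_mul_pi_le_lintegral {S Ω : Set E3} {f : E3 → ℝ}
    (hS : IsClosedEmbeddedSurface S) (hΩ : IsOpen Ω) (hSΩ : S ⊆ Ω)
    (hf : ContDiffOn ℝ ∞ f Ω) (hf1 : ∀ x ∈ Ω, ‖gradient f x‖ < 1)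
    (hchord : ∀ p ∈ S, ∀ q ∈ S, p ≠ q → openSegment ℝ p q ⊆ intRegion S →
      |f p - f q| < dist p q) :
    ENNReal.ofReal (16 * Real.pi) ≤
      ∫⁻ p in SPlus S f, ENNReal.ofReal (nullExpansion S f p ^ 2) ∂(areaMeasure S f) := by
  have hfS : ContinuousOn f S := hf.continuousOn.mono hSΩ
  have hch := fun p : S => hS.exists_isOrientedChart p.2 (hΩ.mem_nhds (hSΩ p.2))
  choose φ y₀ r U P h H hpU hUΩ using hch
  obtain ⟨t, ht⟩ := hS.isCompact.elim_finite_subcover U (fun p => (H p).flat.isOpen)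
    fun p hp => Set.mem_iUnion.2 ⟨⟨p, hp⟩, hpU _⟩
  obtain ⟨p₀, hp₀⟩ := hS.isConnected.nonempty
  have hne : Nonempty t := by
    obtain ⟨p, hp⟩ := Set.mem_iUnion.1 (ht hp₀)
    obtain ⟨hpt, -⟩ := Set.mem_iUnion.1 hp
    exact ⟨⟨p, hpt⟩⟩
  obtain ⟨e, he⟩ := exists_surjective_nat t
  let A : ℕ → Set E3 := fun n => SPlus S f ∩ U (e n)
  have hSm : MeasurableSet (SPlus S f) := (isCompact_SPlus hS.isCompact hfS).measurableSet
  have hA : ∀ n, MeasurableSet (A n) := fun n => hSm.inter (H _).flat.isOpen.measurableSet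
  have hAU : ⋃ n, A n = SPlus S f := by
    refine Set.Subset.antisymm (Set.iUnion_subset fun n => Set.inter_subset_left) fun p hp => ?_
    obtain ⟨q, hq⟩ := Set.mem_iUnion.1 (ht hp.1)
    obtain ⟨hqt, hq⟩ := Set.mem_iUnion.1 hq
    obtain ⟨n, hn⟩ := he ⟨q, hqt⟩
    exact Set.mem_iUnion.2 ⟨n, hp, by rw [hn]; exact hq⟩
  let B := disjointed A
  have hBm : ∀ n, MeasurableSet (B n) := MeasurableSet.disjointed hA
  have hBU : ⋃ n, B n = SPlus S f := (iUnion_disjointed (f := A)).trans hAU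
  let cone : ℕ → Set E3 := fun n => {x | ∃ t ∈ Set.Ioo (0 : ℝ) 1, ∃ p ∈ B n, ∃ w : E3, ‖w‖ = 1 ∧
        IsMinOn (fun q => f q - inner ℝ q w) S p ∧ x = t • w}
  have hcover : Metric.ball (0 : E3) 1 ⊆ {0} ∪ ⋃ n, cone n := by
    intro x hx
    by_cases hx0 : x = 0
    · exact Or.inl hx0
    right
    have hxn : 0 < ‖x‖ := norm_pos_iff.2 hx0
    have hw := norm_inv_norm_smul_self hx0
    have hc : ContinuousOn (fun q => f q - inner ℝ q (‖x‖⁻¹ • x)) S :=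
      hfS.sub (by fun_prop)
    obtain ⟨p, hp, hmin⟩ := hS.isCompact.exists_isMinOn hS.isConnected.nonempty hc
    have hpS : p ∈ SPlus S f := mem_SPlus_iff.2 ⟨hp, _, hw, hmin⟩
    rw [← hBU] at hpS
    obtain ⟨n, hn⟩ := Set.mem_iUnion.1 hpS
    refine Set.mem_iUnion.2 ⟨n, ‖x‖, ⟨hxn, by simpa using hx⟩, p, hn, _, hw, hmin, ?_⟩
    rw [smul_smul, mul_inv_cancel₀ hxn.ne', one_smul]
  have hvol : ENNReal.ofReal (Real.pi * 4 / 3) ≤ ENNReal.ofReal (1 / 12) *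
      ∫⁻ p in SPlus S f, ENNReal.ofReal (nullExpansion S f p ^ 2) ∂(areaMeasure S f) := by
    calc ENNReal.ofReal (Real.pi * 4 / 3) = volume (Metric.ball (0 : E3) 1) := by
          rw [EuclideanSpace.volume_ball_fin_three]; simp
      _ ≤ volume ({0} ∪ ⋃ n, cone n) := measure_mono hcover
      _ ≤ volume ({0} : Set E3) + volume (⋃ n, cone n) := measure_union_le _ _
      _ = volume (⋃ n, cone n) := by rw [measure_singleton, zero_add]
      _ ≤ ∑' n, volume (cone n) := measure_iUnion_le _
      _ ≤ ∑' n, ENNReal.ofReal (1 / 12) *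
          ∫⁻ p in B n, ENNReal.ofReal (nullExpansion S f p ^ 2) ∂(areaMeasure S f) :=
          ENNReal.tsum_le_tsum fun n => (H (e n)).volume_cone_le_lintegral hS hΩ hSΩ (hUΩ _) hf hf1
            hchord (hBm n) ((disjointed_subset A n).trans Set.inter_subset_right)
            ((disjointed_subset A n).trans Set.inter_subset_left)
      _ = _ := by
          rw [ENNReal.tsum_mul_left, ← lintegral_iUnion hBm (disjoint_disjointed A), hBU]
  calc ENNReal.ofReal (16 * Real.pi)
      = ENNReal.ofReal 12 * ENNReal.ofReal (Real.pi * 4 / 3) := by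
        rw [← ENNReal.ofReal_mul (by norm_num)]; congr 1; ring
    _ ≤ ENNReal.ofReal 12 * (ENNReal.ofReal (1 / 12) *
        ∫⁻ p in SPlus S f, ENNReal.ofReal (nullExpansion S f p ^ 2) ∂(areaMeasure S f)) := by
        gcongr
    _ = _ := by
        rw [← mul_assoc, ← ENNReal.ofReal_mul (by norm_num)]; norm_num

theorem proposition4p2
    (Ω : Set E3) (hΩ_open : IsOpen Ω) (hΩ_conn : IsConnected Ω)
    (f : E3 → ℝ) (hf : ContDiffOn ℝ ∞ f Ω) (hf_spacelike : ∀ x ∈ Ω, ‖gradient f x‖ < 1)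
    (S : Set E3) (hS : IsClosedEmbeddedSurface S) (hSΩ : S ⊆ Ω)
    (hf_chord : ∀ p ∈ S, ∀ q ∈ S, p ≠ q → openSegment ℝ p q ⊆ intRegion S →
      |f p - f q| < dist p q) :
    (SPlus S f).Nonempty ∧
    MeasureTheory.IntegrableOn (fun p => nullExpansion S f p ^ 2) (SPlus S f) (areaMeasure S f) ∧
    16 * (1 + Real.sqrt 2) * Real.pi / 3 * (⨅ x : Ω, (1 - ‖gradient f (x : E3)‖ ^ 2)) ≤
      ∫ p in SPlus S f, nullExpansion S f p ^ 2 ∂(areaMeasure S f) := by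
  have hfS : ContinuousOn f S := hf.continuousOn.mono hSΩ
  have hfin := isFiniteMeasure_areaMeasure hS hΩ_open hSΩ hf hf_spacelike
  have hcomp := isCompact_SPlus hS.isCompact hfS
  have hint : IntegrableOn (fun p => nullExpansion S f p ^ 2) (SPlus S f) (areaMeasure S f) :=
    (((continuousOn_nullExpansion hS hΩ_open hSΩ hf hf_spacelike).mono
      fun p hp => hp.1).pow 2).integrableOn_compact hcomp
  refine ⟨?_, hint, ?_⟩
  · obtain ⟨w, hw⟩ := exists_norm_eq E3 zero_le_one
    have hc : ContinuousOn (fun q => f q - inner ℝ q w) S := hfS.sub (by fun_prop)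
    obtain ⟨p, hp, hmin⟩ := hS.isCompact.exists_isMinOn hS.isConnected.nonempty hc
    exact ⟨p, mem_SPlus_iff.2 ⟨hp, w, hw, hmin⟩⟩
  · have h16 : 16 * Real.pi ≤ ∫ p in SPlus S f, nullExpansion S f p ^ 2 ∂(areaMeasure S f) := by
      have h1 := ofReal_sixteen_mul_pi_le_lintegral hS hΩ_open hSΩ hf hf_spacelike hf_chord
      rw [← ofReal_integral_eq_lintegral_ofReal hint (ae_of_all _ fun p => sq_nonneg _)] at h1
      exact (ENNReal.ofReal_le_ofReal_iff (integral_nonneg fun p => sq_nonneg _)).1 h1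
    refine le_trans ?_ h16
    obtain ⟨x₀, hx₀⟩ := hΩ_conn.nonempty
    have hinf : ⨅ x : Ω, (1 - ‖gradient f (x : E3)‖ ^ 2) ≤ 1 := by
      refine (ciInf_le ⟨0, ?_⟩ (⟨x₀, hx₀⟩ : Ω)).trans (by simp)
      rintro _ ⟨x, rfl⟩
      have := hf_spacelike x x.2
      have h0 := norm_nonneg (gradient f (x : E3))
      simp only
      nlinarith
    -- `(1 + √2) / 3 < 1`, so that `16 π` is more than what is claimed
    have h2 : Real.sqrt 2 ≤ 2 := Real.sqrt_le_iff.2 ⟨by norm_num, by norm_num⟩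
    have hpi := Real.pi_pos
    calc 16 * (1 + Real.sqrt 2) * Real.pi / 3 * (⨅ x : Ω, (1 - ‖gradient f (x : E3)‖ ^ 2))
        ≤ 16 * (1 + Real.sqrt 2) * Real.pi / 3 * 1 :=
          mul_le_mul_of_nonneg_left hinf (by positivity)
      _ ≤ 16 * Real.pi := by nlinarith
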